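/- **Setting.** For $m>0$ let $\mathfrak F$ be the symmetric Fock space over $L^2(\mathbb R^3,d^3k/(2\pi)^3)$ with vacuum vector $\Omega$, and let $$\Phi(x)=\int\frac{d^3k}{(2\pi)^3\sqrt{2\omega}}\left(a(k)e^{-ik\cdot x}+a^\dagger(k)e^{ik\cdot x}\right),\qquad \omega=(\|k\|^2+m^2)^{1/2},\quad k\cdot x=\omega t-\boldsymbol k\cdot\boldsymbol x ,$$ be the free Klein–Gordon field of mass $m$ on four-dimensional Minkowski space $\mathbb R\times\mathbb R^3$, understood as an operator-valued distribution. A vector $\Psi\in\mathfrak F$ is called Hadamard if it lies in the domain of every smeared field $\Phi(g)$, $g\in C_0^\infty(\mathbb R^4;\mathbb R)$, and the normal ordered two-point function $$\langle\Psi,{:}\Phi(x)\Phi(y){:}\Psi\rangle=\langle\Psi,\Phi(x)\Phi(y)\Psi\rangle-\|\Psi\|^2\langle\Omega,\Phi(x)\Phi(y)\Omega\rangle$$ is a smooth function of $(x,y)$. For such $\Psi$, the expectation value of the energy density $\rho_m=\tfrac12\big({:}(\nabla_0\Phi)^2{:}+\sum_{i=1}^3{:}(\nabla_i\Phi)^2{:}+m^2{:}\Phi^2{:}\big)$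 at $x$ is $$\langle\Psi,\rho_m(x)\Psi\rangle=\tfrac12\Big[\Big(\sum_{\mu=0}^3\partial_{x^\mu}\partial_{y^\mu}+m^2\Big)\langle\Psi,{:}\Phi(x)\Phi(y){:}\Psi\rangle\Big]_{y=x}.$$ The Fourier transform is $\hat f(u)=\int e^{-iut}f(t)\,dt$. **Theorem.** There is an absolute constant $\Gamma_0>0$ with the following property. Let $m_0\ge 0$, and let $f\in C_0^\infty(\mathbb R)$ be real-valued, nonnegative and even, with a Fourier transform (necessarily real and even) that is also nonnegative and satisfies $$\hat f(u)\ge\varphi(|u|)\qquad (u\in[m_0,\infty)),$$ where $\varphi:[m_0,\infty)\to[0,\infty)$ is monotone decreasing (not necessarily strictly). Then for every $m>m_0$ there is a vector $\Psi_m\in\mathfrak F$ with $\|\Psi_m\|=1$ that is Hadamard and is a vacuum-plus-two-particle superposition (its vacuum component is nonzero, and all its components of particle number other than $0$ and $2$ vanish) such that $$\int\langle\Psi_m,\rho_m(t,\boldsymbol 0)\Psi_m\rangle f(t)\,dt\le-\Gamma\,m^4\,\varphi(2\sqrt2\,m)^2,\qquad \Gamma=\frac{\Gamma_0}{\int f(t)\,dt}.$$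 (If $f=0$, then $\varphi=0$ and the right-hand side is read as $0$.) In particular, $\Gamma>0$ depends neither on $m$ nor on $\varphi$ (nor on $m_0$), and it is an absolute constant if $\int f(t)\,dt=1$. -/

import Mathlib

open MeasureTheory Set
open scoped ContDiff NNReal ComplexConjugate

noncomputable section

namespace KleinGordon

/-- Momentum space `ℝ³`. -/
abbrev Momentum : Type := EuclideanSpace ℝ (Fin 3)

/-- Four-dimensional Minkowski space, `(t, x)` with `t ∈ ℝ` and `x ∈ ℝ³`; signature `+---`. -/
abbrev Spacetime : Type := ℝ × EuclideanSpace ℝ (Fin 3)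

/-- The measure `d³k / (2π)³` on momentum space. -/
def momentumMeasure : Measure Momentum :=
  (Real.toNNReal (((2 * Real.pi) ^ 3)⁻¹)) • (volume : Measure Momentum)

instance : SigmaFinite momentumMeasure := by
  unfold momentumMeasure; infer_instance

/-- The product measure `d³k₁ / (2π)³ ⋯ d³kₙ / (2π)³`. -/
abbrev nMeasure (n : ℕ) : Measure (Fin n → Momentum) :=
  Measure.pi fun _ => momentumMeasure

/-- Permuting the momenta preserves the product measure. -/
theorem measurePreserving_perm (n : ℕ) (σ : Equiv.Perm (Fin n)) :
    MeasurePreserving (fun k : Fin n → Momentum => k ∘ σ) (nMeasure n) (nMeasure n) := by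
  have h := measurePreserving_piCongrLeft (fun _ : Fin n => momentumMeasure) σ.symm
  convert h using 1
  ext k i
  simp [MeasurableEquiv.piCongrLeft, Equiv.piCongrLeft, Equiv.piCongrLeft']

/-- The `n`-particle space: the elements of `L²((ℝ³)ⁿ)` that are symmetric under permutation of
the momenta. For `n = 0` this is a copy of `ℂ`. -/
def NParticle (n : ℕ) : Submodule ℂ (Lp ℂ 2 (nMeasure n)) where
  carrier := {ψ | ∀ σ : Equiv.Perm (Fin n), (fun k => ψ (k ∘ σ)) =ᵐ[nMeasure n] ψ}
  zero_mem' := by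
    intro σ
    have h0 := Lp.coeFn_zero ℂ 2 (nMeasure n)
    filter_upwards [h0, (measurePreserving_perm n σ).quasiMeasurePreserving.ae h0] with k h1 h2
    rw [h1, h2]; rfl
  add_mem' := by
    intro a b ha hb σ
    have h0 := Lp.coeFn_add a b
    filter_upwards [h0, (measurePreserving_perm n σ).quasiMeasurePreserving.ae h0,
      ha σ, hb σ] with k h1 h2 h3 h4
    rw [h1, h2, Pi.add_apply, Pi.add_apply, h3, h4]
  smul_mem' := by
    intro c a ha σ
    have h0 := Lp.coeFn_smul c a
    filter_upwards [h0, (measurePreserving_perm n σ).quasiMeasurePreserving.ae h0,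
      ha σ] with k h1 h2 h3
    rw [h1, h2, Pi.smul_apply, Pi.smul_apply, h3]

/-- The symmetric Fock space over `L²(ℝ³, d³k / (2π)³)`: the Hilbert space direct sum of the
`n`-particle spaces. -/
abbrev Fock : Type := lp (fun n : ℕ => NParticle n) 2

/-- The `n`-particle wave function `Ψ⁽ⁿ⁾(k₁, …, kₙ)` of a Fock space vector. -/
def comp (Ψ : Fock) (n : ℕ) : (Fin n → Momentum) → ℂ :=
  ((Ψ n : NParticle n) : Lp ℂ 2 (nMeasure n))

instance : IsFiniteMeasure (nMeasure 0) := by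
  unfold nMeasure; rw [Measure.pi_of_empty]; infer_instance

/-- The constant function `1` in the zero-particle space. -/
def vacuumComp : NParticle 0 :=
  ⟨(memLp_const (1 : ℂ)).toLp (fun _ : Fin 0 → Momentum => (1 : ℂ)), by
    intro σ
    refine Filter.Eventually.of_forall fun k => ?_
    exact congrArg _ (Subsingleton.elim _ _)⟩

/-- The Fock vacuum vector `Ω`. -/
def vacuum : Fock := lp.single 2 0 vacuumComp

/-- The `n`-particle component of `a(u) Ψ`, `a(u) = ∫ d³p/(2π)³ conj (u p) a(p)`, where
`(a(p) Ψ)⁽ⁿ⁾(k₁, …, kₙ) = √(n+1) Ψ⁽ⁿ⁺¹⁾(p, k₁, …, kₙ)`. -/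
def annihilateComp (u : Momentum → ℂ) (Ψ : Fock) (n : ℕ) (k : Fin n → Momentum) : ℂ :=
  (Real.sqrt (n + 1) : ℂ) *
    ∫ p, conj (u p) * comp Ψ (n + 1) (Fin.cons p k) ∂momentumMeasure

/-- The `n`-particle component of `a†(u) Ψ`, `a†(u) = ∫ d³p/(2π)³ u p a†(p)`; that is,
`(a†(u) Ψ)⁽ⁿ⁺¹⁾(k₀, …, kₙ) = (n+1)^(-1/2) ∑ⱼ u(kⱼ) Ψ⁽ⁿ⁾(k₀, …, kⱼ omitted, …, kₙ)`. -/
def createComp (u : Momentum → ℂ) (Ψ : Fock) : (n : ℕ) → (Fin n → Momentum) → ℂ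
  | 0, _ => 0
  | n + 1, k => ((Real.sqrt (n + 1))⁻¹ : ℂ) *
      ∑ j : Fin (n + 1), u (k j) * comp Ψ n (fun i => k (j.succAbove i))

/-- Energy `ω(k) = (‖k‖² + m²)^(1/2)`. -/
def energy (m : ℝ) (k : Momentum) : ℝ := Real.sqrt (‖k‖ ^ 2 + m ^ 2)

/-- Real test functions on spacetime. -/
def IsTest (g : Spacetime → ℝ) : Prop := ContDiff ℝ ∞ g ∧ HasCompactSupport g

/-- The one-particle vector of a test function,
`(K g)(k) = (2ω)^(-1/2) ∫ d⁴x e^{i(ω t - k·x)} g(t, x)`. -/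
def oneParticle (m : ℝ) (g : Spacetime → ℝ) (k : Momentum) : ℂ :=
  ((Real.sqrt (2 * energy m k))⁻¹ : ℂ) *
    ∫ x : Spacetime, Complex.exp (Complex.I * (energy m k * x.1 - inner ℝ k x.2 : ℝ)) * (g x : ℂ)

/-- The graph of the smeared Klein-Gordon field `Φ(g) = a(K g) + a†(K g)`, which is the integral
against `g` of `Φ(x) = ∫ d³k/((2π)³ √(2ω)) (a(k) e^{-ik·x} + a†(k) e^{ik·x})`:
`Ψ` is in the domain and `Φ(g) Ψ = Ξ`. The domain is the maximal one. -/
def FieldGraph (m : ℝ) (g : Spacetime → ℝ) (Ψ Ξ : Fock) : Prop :=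
  ∀ n : ℕ, comp Ξ n =ᵐ[nMeasure n] fun k =>
    annihilateComp (oneParticle m g) Ψ n k + createComp (oneParticle m g) Ψ n k

/-- The domain of the unbounded operator `Φ(g)`. -/
def fieldDomain (m : ℝ) (g : Spacetime → ℝ) : Set Fock := {Ψ | ∃ Ξ, FieldGraph m g Ψ Ξ}

theorem FieldGraph.unique {m : ℝ} {g : Spacetime → ℝ} {Ψ Ξ Ξ' : Fock}
    (h : FieldGraph m g Ψ Ξ) (h' : FieldGraph m g Ψ Ξ') : Ξ = Ξ' := by
  apply lp.ext
  funext n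
  apply Subtype.ext
  exact Lp.ext ((h n).trans (h' n).symm)

open Classical in
/-- `Φ(g) Ψ` for `Ψ` in the domain of `Φ(g)` (and `0` otherwise). -/
def field (m : ℝ) (g : Spacetime → ℝ) (Ψ : Fock) : Fock :=
  if h : Ψ ∈ fieldDomain m g then h.choose else 0

theorem FieldGraph.field_eq {m : ℝ} {g : Spacetime → ℝ} {Ψ Ξ : Fock}
    (h : FieldGraph m g Ψ Ξ) : field m g Ψ = Ξ := by
  have hd : Ψ ∈ fieldDomain m g := ⟨Ξ, h⟩
  rw [field, dif_pos hd]
  exact hd.choose_spec.unique h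

/-- The two-point function `⟨Ψ, Φ(g) Φ(h) Ψ⟩ = ⟨Φ(g) Ψ, Φ(h) Ψ⟩` on real test functions. -/
def twoPoint (m : ℝ) (Ψ : Fock) (g h : Spacetime → ℝ) : ℂ :=
  inner ℂ (field m g Ψ) (field m h Ψ)

/-- `F` is a smooth function and is the integral kernel of the normal ordered two-point function
`⟨Ψ, :Φ(x) Φ(y): Ψ⟩`, with `:Φ(g) Φ(h): = Φ(g) Φ(h) - ⟨Ω, Φ(g) Φ(h) Ω⟩ 1`. -/
def IsWickKernel (m : ℝ) (Ψ : Fock) (F : Spacetime × Spacetime → ℂ) : Prop :=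
  ContDiff ℝ ∞ F ∧ ∀ g h : Spacetime → ℝ, IsTest g → IsTest h →
    twoPoint m Ψ g h - (‖Ψ‖ : ℂ) ^ 2 * twoPoint m vacuum g h =
      ∫ y : Spacetime, (∫ x : Spacetime, F (x, y) * (g x : ℂ)) * (h y : ℂ)

/-- Hadamard vectors: the two-point function exists and has the same singular part as that of the
Minkowski vacuum, that is, the difference of the two is a smooth function. -/
def IsHadamard (m : ℝ) (Ψ : Fock) : Prop :=
  (∀ g, IsTest g → Ψ ∈ fieldDomain m g) ∧ ∃ F, IsWickKernel m Ψ F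

/-- A continuous function on spacetime is determined by its integrals against test functions. -/
theorem eq_of_forall_test {G G' : Spacetime → ℂ} (hG : Continuous G) (hG' : Continuous G')
    (h : ∀ g, IsTest g → ∫ x, G x * (g x : ℂ) = ∫ x, G' x * (g x : ℂ)) : G = G' := by
  refine (Continuous.ae_eq_iff_eq (volume : Measure Spacetime) hG hG').1 ?_
  have hl : LocallyIntegrable G (volume : Measure Spacetime) := hG.locallyIntegrable
  have hl' : LocallyIntegrable G' (volume : Measure Spacetime) := hG'.locallyIntegrable
  refine ae_eq_of_integral_contDiff_smul_eq hl hl' ?_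
  intro g hg hc
  have := h g ⟨hg, hc⟩
  simpa [mul_comm] using this

/-- The smooth kernel of the normal ordered two-point function is unique. -/
theorem IsWickKernel.unique {m : ℝ} {Ψ : Fock} {F F' : Spacetime × Spacetime → ℂ}
    (hF : IsWickKernel m Ψ F) (hF' : IsWickKernel m Ψ F') : F = F' := by
  have key : ∀ {F : Spacetime × Spacetime → ℂ}, ContDiff ℝ ∞ F → ∀ g, IsTest g →
      Continuous fun y : Spacetime => ∫ x : Spacetime, F (x, y) * (g x : ℂ) := by
    intro F hF g hg
    have hgc : Continuous g := hg.1.continuous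
    have hFc : Continuous F := hF.continuous
    have hcont : Continuous fun y : Spacetime =>
        ∫ x in tsupport g, F (x, y) * (g x : ℂ) ∂(volume : Measure Spacetime) :=
      continuous_parametric_integral_of_continuous (by fun_prop) hg.2
    refine hcont.congr ?_
    · intro y
      refine setIntegral_eq_integral_of_forall_compl_eq_zero fun x hx => ?_
      simp [image_eq_zero_of_notMem_tsupport hx]
  have hc : Continuous F := hF.1.continuous
  have hc' : Continuous F' := hF'.1.continuous
  have h1 : ∀ y, (fun x => F (x, y)) = fun x => F' (x, y) := by
    intro y
    refine eq_of_forall_test (by fun_prop) (by fun_prop) fun g hg => ?_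
    have := eq_of_forall_test (key hF.1 g hg) (key hF'.1 g hg) fun h hh =>
      (hF.2 g h hg hh).symm.trans (hF'.2 g h hg hh)
    exact congrFun this y
  funext ⟨x, y⟩
  exact congrFun (h1 y) x

open Classical in
/-- The smooth function `(x, y) ↦ ⟨Ψ, :Φ(x) Φ(y): Ψ⟩` of a Hadamard vector `Ψ`. -/
def wickKernel (m : ℝ) (Ψ : Fock) : Spacetime × Spacetime → ℂ :=
  if h : ∃ F, IsWickKernel m Ψ F then h.choose else 0

theorem IsWickKernel.wickKernel_eq {m : ℝ} {Ψ : Fock} {F : Spacetime × Spacetime → ℂ}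
    (hF : IsWickKernel m Ψ F) : wickKernel m Ψ = F := by
  have h : ∃ F, IsWickKernel m Ψ F := ⟨F, hF⟩
  rw [wickKernel, dif_pos h]
  exact h.choose_spec.unique hF

/-- The derivative of `F(x, y)` in direction `v` with respect to both `x` and `y`, evaluated at
`y = x`. For the Wick kernel of `Ψ` this is `⟨Ψ, :(∂_v Φ(x))²: Ψ⟩`. -/
def coincidenceDeriv (F : Spacetime × Spacetime → ℂ) (v x : Spacetime) : ℂ :=
  deriv (fun s : ℝ => deriv (fun r : ℝ => F (x + r • v, x + s • v)) 0) 0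

/-- The expectation value `⟨Ψ, ρ_m(x) Ψ⟩` of the energy density
`ρ_m = ½ (:(∇₀Φ)²: + ∑ᵢ :(∇ᵢΦ)²: + m² :Φ²:)` in a Hadamard vector `Ψ`. It is real because `ρ_m(x)`
is a hermitian form; taking the real part only fixes the type. -/
def energyDensity (m : ℝ) (Ψ : Fock) (x : Spacetime) : ℝ :=
  ((1 / 2 : ℂ) * (coincidenceDeriv (wickKernel m Ψ) (1, 0) x
    + ∑ i : Fin 3, coincidenceDeriv (wickKernel m Ψ) (0, EuclideanSpace.single i 1) x
    + (m : ℂ) ^ 2 * wickKernel m Ψ (x, x))).re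

/-- `Ψ` is a superposition of the vacuum and a two-particle vector: all other components vanish,
and the vacuum component does not. -/
def IsVacuumPlusTwoParticle (Ψ : Fock) : Prop :=
  Ψ 0 ≠ 0 ∧ ∀ n : ℕ, n ≠ 0 → n ≠ 2 → Ψ n = 0

/-- The Fourier transform `∫ e^{-iut} f(t) dt`. -/
def fourier (f : ℝ → ℝ) (u : ℝ) : ℂ :=
  ∫ t : ℝ, Complex.exp (-Complex.I * u * t) * (f t : ℂ)

end KleinGordon

end

/-!
The vector is `Ψ = a Ω + c b ⊗ b`, where `b(k) = √(2ω)` on the shell `m / 2 ≤ ‖k‖ ≤ m` and `b = 0`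
elsewhere. A field `Φ(g)` acts on it through its one-particle vector `u = K g`, and the canonical
commutation relations (`inner_fieldState`) say that `⟨Φ(g)Ψ, Φ(g')Ψ⟩` is the vacuum two-point function
times `‖Ψ‖²` plus terms in which `g` and `g'` enter only through `⟨K g, b⟩` and `⟨K g', b⟩`. By the
choice of `b`, `⟨K g, b⟩ = ∫ g(x) h(x) d⁴x` with the mode function `h(x) = ∫ e^{-i(ωt - k·x)}` over
the shell (`pairing_oneParticle_profile`). So the normal ordered two-point function has the kernel
`√2 a c (h(x) h(y) + c.c.) + 2 c² ‖b‖² (conj h(x) h(y) + c.c.)` (`isWickKernel_shellKernel`), which is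
smooth because the shell is bounded. That `K g` is square integrable, so that `Φ(g) Ψ` exists, follows
from two integrations by parts in each spatial direction (`memLp_oneParticle`).

On the time axis the spatial gradient of `h` vanishes by reflection symmetry, and the energy density
is `√2 a c Re((∂ₜh)² + m² h²) + 2 c² ‖b‖² (|∂ₜh|² + m² |h|²)` (`energyDensity_shellState`). Averaged
against `f`, the first term becomes `-√2 a c ∫∫ (ω ω' - m²) f̂(ω + ω')`. On the shell `ω ω' - m²` is
at least `m² / 4`, and `2 m ≤ ω + ω' ≤ 2√2 m`, so that `f̂(ω + ω') ≥ φ(2√2 m)`: this term is negative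
and linear in `c` (`integral_interference_re_le`). The second term is quadratic in `c` and at most a
constant times `∫ f`. Choosing `c` of order `φ(2√2 m) / ∫ f`, where the sum of the two is smallest,
gives the bound; the power of `m` comes from the volume of the shell.
-/

noncomputable section

namespace KleinGordon

/-! ### Wave functions in Fock space -/

/-- The `n`-particle vector with a given symmetric square integrable wave function. -/
def particle {n : ℕ} (ψ : (Fin n → Momentum) → ℂ) (hψ : MemLp ψ 2 (nMeasure n))
    (hs : ∀ (σ : Equiv.Perm (Fin n)) k, ψ (k ∘ σ) = ψ k) : NParticle n :=
  ⟨hψ.toLp ψ, by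
    intro σ
    have h := hψ.coeFn_toLp
    filter_upwards [h, (measurePreserving_perm n σ).quasiMeasurePreserving.ae h] with k h1 h2
    rw [h1, h2, hs]⟩

theorem coe_particle {n : ℕ} {ψ : (Fin n → Momentum) → ℂ} (hψ : MemLp ψ 2 (nMeasure n))
    (hs : ∀ (σ : Equiv.Perm (Fin n)) k, ψ (k ∘ σ) = ψ k) :
    ((particle ψ hψ hs : NParticle n) : Lp ℂ 2 (nMeasure n)) =ᵐ[nMeasure n] ψ :=
  hψ.coeFn_toLp

theorem inner_particle {n : ℕ} {ψ χ : (Fin n → Momentum) → ℂ} (hψ : MemLp ψ 2 (nMeasure n))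
    (hs : ∀ (σ : Equiv.Perm (Fin n)) k, ψ (k ∘ σ) = ψ k) (hχ : MemLp χ 2 (nMeasure n))
    (ht : ∀ (σ : Equiv.Perm (Fin n)) k, χ (k ∘ σ) = χ k) :
    inner ℂ (particle ψ hψ hs) (particle χ hχ ht) = ∫ k, conj (ψ k) * χ k ∂nMeasure n := by
  rw [Submodule.coe_inner, L2.inner_def]
  refine integral_congr_ae ?_
  filter_upwards [coe_particle hψ hs, coe_particle hχ ht] with k h1 h2
  rw [h1, h2, RCLike.inner_apply, mul_comm]

/-- The Fock space vector whose only nonzero components are the given ones, in the sectors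
`i` and `j`. -/
def twoSector (i j : ℕ) (a : NParticle i) (b : NParticle j) : Fock :=
  lp.single 2 i a + lp.single 2 j b

theorem twoSector_left {i j : ℕ} (hij : i ≠ j) (a : NParticle i) (b : NParticle j) :
    (twoSector i j a b) i = a := by
  simp [twoSector, hij]

theorem twoSector_right {i j : ℕ} (hij : i ≠ j) (a : NParticle i) (b : NParticle j) :
    (twoSector i j a b) j = b := by
  simp [twoSector, hij.symm]

theorem twoSector_of_ne {i j n : ℕ} (hi : n ≠ i) (hj : n ≠ j) (a : NParticle i)
    (b : NParticle j) : (twoSector i j a b) n = 0 := by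
  simp [twoSector, hi, hj]

theorem inner_twoSector {i j : ℕ} (hij : i ≠ j) (a a' : NParticle i) (b b' : NParticle j) :
    inner ℂ (twoSector i j a b) (twoSector i j a' b') = inner ℂ a a' + inner ℂ b b' := by
  conv_lhs => rw [twoSector, inner_add_left, lp.inner_single_left, lp.inner_single_left,
    twoSector_left hij, twoSector_right hij]

theorem comp_ae_zero {Ψ : Fock} {n : ℕ} (h : Ψ n = 0) : comp Ψ n =ᵐ[nMeasure n] 0 := by
  unfold comp
  rw [h]
  exact Lp.coeFn_zero ℂ 2 (nMeasure n)

/-- A product of square integrable functions of the separate momenta is square integrable. -/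
theorem memLp_prod {n : ℕ} {w : Fin n → Momentum → ℂ} (hw : ∀ i, MemLp (w i) 2 momentumMeasure) :
    MemLp (fun k : Fin n → Momentum => ∏ i, w i (k i)) 2 (nMeasure n) := by
  have hm : AEStronglyMeasurable (fun k : Fin n → Momentum => ∏ i, w i (k i)) (nMeasure n) := by
    refine Finset.aestronglyMeasurable_fun_prod _ fun i _ => ?_
    exact (hw i).1.comp_quasiMeasurePreserving (Measure.quasiMeasurePreserving_eval _ i)
  rw [memLp_two_iff_integrable_sq_norm hm]
  have : Integrable (fun k : Fin n → Momentum => ∏ i, ‖w i (k i)‖ ^ 2) (nMeasure n) :=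
    Integrable.fintype_prod fun i => (memLp_two_iff_integrable_sq_norm (hw i).1).1 (hw i)
  simpa only [norm_prod, Finset.prod_pow] using this

/-- The `L²` product `⟨u, v⟩` of functions on momentum space. -/
def pairing (u v : Momentum → ℂ) : ℂ := ∫ k, conj (u k) * v k ∂momentumMeasure

theorem conj_pairing (u v : Momentum → ℂ) : conj (pairing u v) = pairing v u := by
  rw [pairing, pairing, ← integral_conj]
  simp [mul_comm]

theorem integral_conj_prod_mul_prod {n : ℕ} (w z : Fin n → Momentum → ℂ) :
    ∫ k, conj (∏ i, w i (k i)) * ∏ i, z i (k i) ∂nMeasure n = ∏ i, pairing (w i) (z i) := by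
  simp only [map_prod, ← Finset.prod_mul_distrib]
  exact integral_fintype_prod_eq_prod (𝕜 := ℂ) fun i x => conj (w i x) * z i x

theorem ae_cons {n : ℕ} {p : (Fin (n + 1) → Momentum) → Prop} (h : ∀ᵐ k ∂nMeasure (n + 1), p k) :
    ∀ᵐ k ∂nMeasure n, ∀ᵐ q ∂momentumMeasure, p (Fin.cons q k) := by
  have h1 := (measurePreserving_piFinSuccAbove (fun _ : Fin (n + 1) => momentumMeasure) 0).symm
  have h2 := (Measure.measurePreserving_swap (μ := nMeasure n) (ν := momentumMeasure))
  have h3 := Measure.ae_ae_of_ae_prod ((h1.comp h2).quasiMeasurePreserving.ae h)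
  simpa [MeasurableEquiv.piFinSuccAbove, Fin.insertNthEquiv] using h3

theorem ae_succAbove {n : ℕ} (j : Fin (n + 1)) {p : (Fin n → Momentum) → Prop}
    (h : ∀ᵐ k ∂nMeasure n, p k) :
    ∀ᵐ k ∂nMeasure (n + 1), p (fun i => k (j.succAbove i)) := by
  have h1 := (measurePreserving_piFinSuccAbove (fun _ : Fin (n + 1) => momentumMeasure) j)
  have h2 := (Measure.quasiMeasurePreserving_snd (μ := momentumMeasure) (ν := nMeasure n)).comp
    h1.quasiMeasurePreserving
  exact h2.ae h

/-- Annihilation may be computed from any representative of the wave function. -/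
theorem annihilateComp_congr {Ψ : Fock} {n : ℕ} {ψ : (Fin (n + 1) → Momentum) → ℂ}
    (h : comp Ψ (n + 1) =ᵐ[nMeasure (n + 1)] ψ) (u : Momentum → ℂ) :
    annihilateComp u Ψ n =ᵐ[nMeasure n] fun k => (Real.sqrt (n + 1) : ℂ) *
      ∫ p, conj (u p) * ψ (Fin.cons p k) ∂momentumMeasure := by
  filter_upwards [ae_cons h] with k hk
  unfold annihilateComp
  congr 1
  refine integral_congr_ae ?_
  filter_upwards [hk] with q hq
  rw [hq]

/-- Creation may be computed from any representative of the wave function. -/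
theorem createComp_congr {Ψ : Fock} {n : ℕ} {ψ : (Fin n → Momentum) → ℂ}
    (h : comp Ψ n =ᵐ[nMeasure n] ψ) (u : Momentum → ℂ) :
    createComp u Ψ (n + 1) =ᵐ[nMeasure (n + 1)] fun k => ((Real.sqrt (n + 1))⁻¹ : ℂ) *
      ∑ j : Fin (n + 1), u (k j) * ψ (fun i => k (j.succAbove i)) := by
  filter_upwards [ae_all_iff.2 fun j => ae_succAbove j h] with k hk
  simp only [createComp, hk]

instance : IsProbabilityMeasure (nMeasure 0) := by
  unfold nMeasure
  rw [Measure.pi_of_empty]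
  infer_instance

/-! ### Superpositions of the vacuum and a product two-particle vector -/

/-- The two-particle wave function `c b(k₀) b(k₁)`. -/
def pairWave (c : ℝ) (b : Momentum → ℂ) (k : Fin 2 → Momentum) : ℂ := c * ∏ i, b (k i)

/-- The zero-particle wave function `a`. -/
def constWave (a : ℝ) (_ : Fin 0 → Momentum) : ℂ := a

theorem memLp_pairWave (c : ℝ) {b : Momentum → ℂ} (hb : MemLp b 2 momentumMeasure) :
    MemLp (pairWave c b) 2 (nMeasure 2) :=
  (memLp_prod fun _ => hb).const_mul (c : ℂ)

theorem memLp_constWave (a : ℝ) : MemLp (constWave a) 2 (nMeasure 0) := memLp_const _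

theorem constWave_symm (a : ℝ) (σ : Equiv.Perm (Fin 0)) (k : Fin 0 → Momentum) :
    constWave a (k ∘ σ) = constWave a k := rfl

theorem pairWave_symm (c : ℝ) (b : Momentum → ℂ) (σ : Equiv.Perm (Fin 2)) (k : Fin 2 → Momentum) :
    pairWave c b (k ∘ σ) = pairWave c b k := by
  unfold pairWave
  congr 1
  exact Equiv.prod_comp σ fun i => b (k i)

/-- The vector `a Ω + c b ⊗ b`. -/
def pairState (a c : ℝ) {b : Momentum → ℂ} (hb : MemLp b 2 momentumMeasure) : Fock :=
  twoSector 0 2 (particle (constWave a) (memLp_constWave a) (constWave_symm a))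
    (particle (pairWave c b) (memLp_pairWave c hb) (pairWave_symm c b))

/-- The one-particle component `a u + √2 c ⟨u, b⟩ b` of `(a(u) + a†(u)) (a Ω + c b ⊗ b)`. -/
def fieldWave₁ (a c : ℝ) (b u : Momentum → ℂ) (k : Fin 1 → Momentum) : ℂ :=
  a * u (k 0) + Real.sqrt 2 * c * pairing u b * b (k 0)

/-- The factor at momentum `i` in the product in which `u` stands at `j` and `b` elsewhere. -/
def slot (b u : Momentum → ℂ) (j i : Fin 3) : Momentum → ℂ := if i = j then u else b

/-- The three-particle component of `(a(u) + a†(u)) (a Ω + c b ⊗ b)`, which is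
`3^(-1/2) c (u ⊗ b ⊗ b + b ⊗ u ⊗ b + b ⊗ b ⊗ u)`. -/
def fieldWave₃ (c : ℝ) (b u : Momentum → ℂ) (k : Fin 3 → Momentum) : ℂ :=
  ((Real.sqrt 3)⁻¹ * c : ℝ) * ∑ j, ∏ i, slot b u j i (k i)

theorem fieldWave₁_symm (a c : ℝ) (b u : Momentum → ℂ) (σ : Equiv.Perm (Fin 1))
    (k : Fin 1 → Momentum) : fieldWave₁ a c b u (k ∘ σ) = fieldWave₁ a c b u k := by
  rw [Subsingleton.elim σ 1]
  rfl

theorem fieldWave₃_symm (c : ℝ) (b u : Momentum → ℂ) (σ : Equiv.Perm (Fin 3))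
    (k : Fin 3 → Momentum) : fieldWave₃ c b u (k ∘ σ) = fieldWave₃ c b u k := by
  unfold fieldWave₃
  congr 1
  rw [← Equiv.sum_comp σ fun j => ∏ i, slot b u j i (k i)]
  refine Finset.sum_congr rfl fun j _ => ?_
  rw [← Equiv.prod_comp σ fun i => slot b u (σ j) i (k i)]
  simp [slot]

theorem memLp_fieldWave₁ (a c : ℝ) {b u : Momentum → ℂ} (hb : MemLp b 2 momentumMeasure)
    (hu : MemLp u 2 momentumMeasure) : MemLp (fieldWave₁ a c b u) 2 (nMeasure 1) := by
  have h : ∀ {w : Momentum → ℂ}, MemLp w 2 momentumMeasure →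
      MemLp (fun k : Fin 1 → Momentum => w (k 0)) 2 (nMeasure 1) := fun hw => by
    simpa using memLp_prod (n := 1) fun _ => hw
  exact ((h hu).const_mul (a : ℂ)).add ((h hb).const_mul (Real.sqrt 2 * c * pairing u b))

theorem memLp_slot {b u : Momentum → ℂ} (hb : MemLp b 2 momentumMeasure)
    (hu : MemLp u 2 momentumMeasure) (j i : Fin 3) : MemLp (slot b u j i) 2 momentumMeasure := by
  unfold slot
  split_ifs
  exacts [hu, hb]

theorem memLp_fieldWave₃ (c : ℝ) {b u : Momentum → ℂ} (hb : MemLp b 2 momentumMeasure)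
    (hu : MemLp u 2 momentumMeasure) : MemLp (fieldWave₃ c b u) 2 (nMeasure 3) :=
  (memLp_finsetSum _ fun j _ => memLp_prod fun i => memLp_slot hb hu j i).const_mul _

/-- The vector `(a(u) + a†(u)) (a Ω + c b ⊗ b)`. -/
def fieldState (a c : ℝ) {b u : Momentum → ℂ} (hb : MemLp b 2 momentumMeasure)
    (hu : MemLp u 2 momentumMeasure) : Fock :=
  twoSector 1 3
    (particle (fieldWave₁ a c b u) (memLp_fieldWave₁ a c hb hu) (fieldWave₁_symm a c b u))
    (particle (fieldWave₃ c b u) (memLp_fieldWave₃ c hb hu) (fieldWave₃_symm c b u))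

theorem comp_pairState_zero (a c : ℝ) {b : Momentum → ℂ} (hb : MemLp b 2 momentumMeasure) :
    comp (pairState a c hb) 0 =ᵐ[nMeasure 0] constWave a := by
  unfold comp pairState
  rw [twoSector_left (by norm_num)]
  exact coe_particle _ _

theorem comp_pairState_two (a c : ℝ) {b : Momentum → ℂ} (hb : MemLp b 2 momentumMeasure) :
    comp (pairState a c hb) 2 =ᵐ[nMeasure 2] pairWave c b := by
  unfold comp pairState
  rw [twoSector_right (by norm_num)]
  exact coe_particle _ _

theorem pairState_of_ne (a c : ℝ) {b : Momentum → ℂ} (hb : MemLp b 2 momentumMeasure) {n : ℕ}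
    (h0 : n ≠ 0) (h2 : n ≠ 2) : pairState a c hb n = 0 :=
  twoSector_of_ne h0 h2 _ _

theorem annihilate_ae_zero {Ψ : Fock} {n : ℕ} (h : Ψ (n + 1) = 0) (u : Momentum → ℂ) :
    annihilateComp u Ψ n =ᵐ[nMeasure n] 0 :=
  (annihilateComp_congr (comp_ae_zero h) u).trans (by simp; rfl)

theorem create_ae_zero {Ψ : Fock} {n : ℕ} (h : Ψ n = 0) (u : Momentum → ℂ) :
    createComp u Ψ (n + 1) =ᵐ[nMeasure (n + 1)] 0 :=
  (createComp_congr (comp_ae_zero h) u).trans (by simp; rfl)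

/-- The field operator with one-particle vector `u` maps `a Ω + c b ⊗ b` to `fieldState`. -/
theorem fieldState_graph (a c : ℝ) {b u : Momentum → ℂ} (hb : MemLp b 2 momentumMeasure)
    (hu : MemLp u 2 momentumMeasure) (n : ℕ) :
    comp (fieldState a c hb hu) n =ᵐ[nMeasure n] fun k =>
      annihilateComp u (pairState a c hb) n k + createComp u (pairState a c hb) n k := by
  have hz : ∀ n, n ≠ 1 → n ≠ 3 → comp (fieldState a c hb hu) n =ᵐ[nMeasure n] 0 :=
    fun n h1 h3 => comp_ae_zero (twoSector_of_ne h1 h3 _ _)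
  match n with
  | 0 =>
    filter_upwards [hz 0 (by norm_num) (by norm_num),
      annihilate_ae_zero (pairState_of_ne a c hb (n := 1) (by norm_num) (by norm_num)) u]
      with k h1 h2
    rw [h1, h2]
    simp [createComp]
  | 1 =>
    have h1 : comp (fieldState a c hb hu) 1 =ᵐ[nMeasure 1] fieldWave₁ a c b u := by
      unfold comp fieldState
      rw [twoSector_left (by norm_num)]
      exact coe_particle _ _
    filter_upwards [h1, annihilateComp_congr (comp_pairState_two a c hb) u,
      createComp_congr (comp_pairState_zero a c hb) u] with k h1 h2 h3
    rw [h1, h2, h3]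
    have e : ∀ p, conj (u p) * pairWave c b (Fin.cons p k) =
        (c * b (k 0)) * (conj (u p) * b p) := by
      intro p
      simp [pairWave, Fin.prod_univ_two]
      ring
    simp_rw [e]
    rw [integral_const_mul]
    simp [fieldWave₁, constWave, pairing]
    norm_num
    ring
  | 2 =>
    filter_upwards [hz 2 (by norm_num) (by norm_num),
      annihilate_ae_zero (pairState_of_ne a c hb (n := 3) (by norm_num) (by norm_num)) u,
      create_ae_zero (pairState_of_ne a c hb (n := 1) (by norm_num) (by norm_num)) u]
      with k h1 h2 h3
    rw [h1, h2, h3]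
    simp
  | 3 =>
    have h1 : comp (fieldState a c hb hu) 3 =ᵐ[nMeasure 3] fieldWave₃ c b u := by
      unfold comp fieldState
      rw [twoSector_right (by norm_num)]
      exact coe_particle _ _
    filter_upwards [h1,
      annihilate_ae_zero (pairState_of_ne a c hb (n := 4) (by norm_num) (by norm_num)) u,
      createComp_congr (comp_pairState_two a c hb) u] with k h1 h2 h3
    rw [h1, h2, h3]
    have e0 : ((2 : Fin 3).succAbove 0) = 0 := rfl
    have e1 : ((2 : Fin 3).succAbove 1) = 1 := rfl
    have e2 : ((1 : Fin 3).succAbove 0) = 0 := rfl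
    have e3 : ((1 : Fin 3).succAbove 1) = 2 := rfl
    have e4 : ((0 : Fin 3).succAbove 0) = 1 := rfl
    have e5 : ((0 : Fin 3).succAbove 1) = 2 := rfl
    have e6 : Real.sqrt (((2 : ℕ) : ℝ) + 1) = Real.sqrt 3 := by norm_num
    have s (F : Fin (2 + 1) → ℂ) : ∑ j, F j = F 0 + F 1 + F 2 := Fin.sum_univ_three F
    rw [e6, s]
    simp only [fieldWave₃, slot, pairWave, Fin.sum_univ_three, Fin.prod_univ_three,
      Fin.prod_univ_two, e0, e1, e2, e3, e4, e5]
    simp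
    ring
  | n + 4 =>
    filter_upwards [hz (n + 4) (by omega) (by omega),
      annihilate_ae_zero (pairState_of_ne a c hb (n := n + 5) (by omega) (by omega)) u,
      create_ae_zero (pairState_of_ne a c hb (n := n + 3) (by omega) (by omega)) u]
      with k h1 h2 h3
    rw [h1, h2, h3]
    simp

theorem inner_pairState (a c : ℝ) {b : Momentum → ℂ} (hb : MemLp b 2 momentumMeasure) :
    inner ℂ (pairState a c hb) (pairState a c hb) = (a : ℂ) ^ 2 + c ^ 2 * pairing b b ^ 2 := by
  unfold pairState
  rw [inner_twoSector (by norm_num), inner_particle, inner_particle]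
  have e : ∀ k : Fin 2 → Momentum, conj (pairWave c b k) * pairWave c b k =
      (c : ℂ) ^ 2 * (conj (∏ i, b (k i)) * ∏ i, b (k i)) := by
    intro k
    simp only [pairWave, map_mul, Complex.conj_ofReal]
    ring
  simp_rw [e]
  rw [integral_const_mul, integral_conj_prod_mul_prod (fun _ => b) fun _ => b]
  simp [constWave, pow_two]

theorem integrable_conj_mul {n : ℕ} {ψ χ : (Fin n → Momentum) → ℂ}
    (hψ : MemLp ψ 2 (nMeasure n)) (hχ : MemLp χ 2 (nMeasure n)) :
    Integrable (fun k => conj (ψ k) * χ k) (nMeasure n) :=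
  MemLp.integrable_mul hψ.star hχ

/-- The canonical commutation relations, for vectors of the form `a Ω + c b ⊗ b`: apart from
`⟨u, v⟩ ‖a Ω + c b ⊗ b‖²`, the product of two fields involves `u` and `v` through their products
with `b` only. -/
theorem inner_fieldState (a c : ℝ) {b u v : Momentum → ℂ} (hb : MemLp b 2 momentumMeasure)
    (hu : MemLp u 2 momentumMeasure) (hv : MemLp v 2 momentumMeasure) :
    inner ℂ (fieldState a c hb hu) (fieldState a c hb hv) =
      ((a : ℂ) ^ 2 + c ^ 2 * pairing b b ^ 2) * pairing u v
      + Real.sqrt 2 * a * c * (pairing u b * pairing v b + pairing b u * pairing b v)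
      + 2 * c ^ 2 * pairing b b * (pairing b u * pairing v b + pairing u b * pairing b v) := by
  unfold fieldState
  rw [inner_twoSector (by norm_num), inner_particle, inner_particle]
  have s2 : ((Real.sqrt 2 : ℝ) : ℂ) ^ 2 = 2 := by norm_cast; simp
  have s3 : (((Real.sqrt 3)⁻¹ : ℝ) : ℂ) ^ 2 = 1 / 3 := by
    rw [← Complex.ofReal_pow, inv_pow, Real.sq_sqrt (by norm_num)]
    norm_num
  have h1 : ∀ {w : Momentum → ℂ}, MemLp w 2 momentumMeasure →
      MemLp (fun k : Fin 1 → Momentum => w (k 0)) 2 (nMeasure 1) := fun hw => by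
    simpa using memLp_prod (n := 1) fun _ => hw
  have p1 : ∀ w z : Momentum → ℂ, ∫ k : Fin 1 → Momentum, conj (w (k 0)) * z (k 0) ∂nMeasure 1 =
      pairing w z := fun w z => by
    simpa using integral_conj_prod_mul_prod (n := 1) (fun _ => w) fun _ => z
  have i1 : ∫ k, conj (fieldWave₁ a c b u k) * fieldWave₁ a c b v k ∂nMeasure 1 =
      a ^ 2 * pairing u v + a * (Real.sqrt 2 * c * pairing v b) * pairing u b
      + (Real.sqrt 2 * c * pairing b u) * a * pairing b v
      + (Real.sqrt 2 * c * pairing b u) * (Real.sqrt 2 * c * pairing v b) * pairing b b := by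
    have e : ∀ k : Fin 1 → Momentum, conj (fieldWave₁ a c b u k) * fieldWave₁ a c b v k =
        a ^ 2 * (conj (u (k 0)) * v (k 0))
        + a * (Real.sqrt 2 * c * pairing v b) * (conj (u (k 0)) * b (k 0))
        + (Real.sqrt 2 * c * pairing b u) * a * (conj (b (k 0)) * v (k 0))
        + (Real.sqrt 2 * c * pairing b u) * (Real.sqrt 2 * c * pairing v b)
          * (conj (b (k 0)) * b (k 0)) := by
      intro k
      simp only [fieldWave₁, map_add, map_mul, Complex.conj_ofReal, conj_pairing]
      ring
    have t1 := (integrable_conj_mul (h1 hu) (h1 hv)).const_mul ((a : ℂ) ^ 2)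
    have t2 := (integrable_conj_mul (h1 hu) (h1 hb)).const_mul
      ((a : ℂ) * (Real.sqrt 2 * c * pairing v b))
    have t3 := (integrable_conj_mul (h1 hb) (h1 hv)).const_mul
      ((Real.sqrt 2 * c * pairing b u) * (a : ℂ))
    have t4 := (integrable_conj_mul (h1 hb) (h1 hb)).const_mul
      (((Real.sqrt 2 : ℝ) * c * pairing b u) * (Real.sqrt 2 * c * pairing v b))
    simp_rw [e]
    refine (integral_add ((t1.add t2).add t3) t4).trans ?_
    rw [integral_add' (t1.add t2) t3, integral_add' t1 t2]
    simp only [integral_const_mul, p1]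
  have i3 : ∫ k, conj (fieldWave₃ c b u k) * fieldWave₃ c b v k ∂nMeasure 3 =
      c ^ 2 * pairing b b ^ 2 * pairing u v
      + 2 * c ^ 2 * pairing b b * (pairing u b * pairing b v) := by
    have e : ∀ k : Fin 3 → Momentum, conj (fieldWave₃ c b u k) * fieldWave₃ c b v k =
        1 / 3 * c ^ 2 * ∑ j, ∑ l, conj (∏ i, slot b u j i (k i)) * ∏ i, slot b v l i (k i) := by
      intro k
      simp only [fieldWave₃, map_mul, Complex.conj_ofReal, Complex.ofReal_mul, map_sum]
      rw [← Finset.sum_mul_sum, ← s3]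
      ring
    simp_rw [e]
    have hint : ∀ j l : Fin 3, Integrable (fun k : Fin 3 → Momentum =>
        conj (∏ i, slot b u j i (k i)) * ∏ i, slot b v l i (k i)) (nMeasure 3) := fun j l =>
      integrable_conj_mul (memLp_prod (memLp_slot hb hu j))
        (memLp_prod (memLp_slot hb hv l))
    rw [integral_const_mul,
      integral_finsetSum _ fun j _ => integrable_finsetSum _ fun l _ => hint j l]
    simp_rw [integral_finsetSum _ fun l _ => hint _ l, integral_conj_prod_mul_prod]
    simp [slot, Fin.sum_univ_three, Fin.prod_univ_three]
    ring
  rw [i1, i3]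
  linear_combination (c ^ 2 * pairing b u * pairing v b * pairing b b) * s2

theorem vacuum_eq_pairState {b : Momentum → ℂ} (hb : MemLp b 2 momentumMeasure) :
    vacuum = pairState 1 0 hb := by
  have h0 : particle (constWave 1) (memLp_constWave 1) (constWave_symm 1) = vacuumComp := by
    refine Subtype.ext ?_
    refine MemLp.toLp_congr (memLp_constWave 1) (memLp_const 1) (Filter.Eventually.of_forall ?_)
    simp [constWave]
  have h2 : particle (pairWave 0 b) (memLp_pairWave 0 hb) (pairWave_symm 0 b) = 0 := by
    refine Subtype.ext (Lp.ext ?_)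
    refine (coe_particle _ _).trans ?_
    filter_upwards [Lp.coeFn_zero ℂ 2 (nMeasure 2)] with k hk
    simp [pairWave]
    exact hk.symm
  unfold pairState twoSector vacuum
  rw [h0, h2]
  simp

theorem isVacuumPlusTwoParticle_pairState {a : ℝ} (ha : a ≠ 0) (c : ℝ) {b : Momentum → ℂ}
    (hb : MemLp b 2 momentumMeasure) : IsVacuumPlusTwoParticle (pairState a c hb) := by
  refine ⟨fun h => ?_, fun n h0 h2 => pairState_of_ne a c hb h0 h2⟩
  have h1 := (comp_pairState_zero a c hb).symm.trans (comp_ae_zero h)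
  have h3 : ∀ᵐ _ : Fin 0 → Momentum ∂nMeasure 0, (a : ℂ) = 0 := h1
  obtain ⟨_, hk⟩ := h3.exists
  exact ha (by exact_mod_cast hk)

/-! ### Decay of the one-particle vectors of test functions -/

/-- The plane wave `e^{i(ω t - k·x)}` on the mass shell. -/
def planeWave (m : ℝ) (k : Momentum) (x : Spacetime) : ℂ :=
  Complex.exp (Complex.I * (energy m k * x.1 - inner ℝ k x.2 : ℝ))

theorem continuous_energy (m : ℝ) : Continuous (energy m) := by
  unfold energy
  fun_prop

theorem le_energy (m : ℝ) (k : Momentum) : m ≤ energy m k :=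
  Real.le_sqrt_of_sq_le (by nlinarith [sq_nonneg ‖k‖])

theorem energy_pos {m : ℝ} (hm : 0 < m) (k : Momentum) : 0 < energy m k :=
  hm.trans_le (le_energy m k)

theorem continuous_planeWave (m : ℝ) :
    Continuous fun p : Momentum × Spacetime => planeWave m p.1 p.2 := by
  have := continuous_energy m
  unfold planeWave
  fun_prop

theorem continuous_planeWave_right (m : ℝ) (k : Momentum) : Continuous (planeWave m k) := by
  unfold planeWave
  fun_prop

theorem norm_planeWave (m : ℝ) (k : Momentum) (x : Spacetime) : ‖planeWave m k x‖ = 1 := by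
  rw [planeWave, mul_comm, Complex.norm_exp_ofReal_mul_I]

/-- The derivative of the plane wave along a line. -/
theorem hasDerivAt_planeWave_line (m : ℝ) (k : Momentum) (x v : Spacetime) (r : ℝ) :
    HasDerivAt (fun r : ℝ => planeWave m k (x + r • v))
      (Complex.I * (energy m k * v.1 - inner ℝ k v.2 : ℝ) * planeWave m k (x + r • v)) r := by
  have h1 : HasDerivAt (fun r : ℝ => energy m k * (x + r • v).1 - inner ℝ k (x + r • v).2)
      (energy m k * v.1 - inner ℝ k v.2) r := by
    have e : (fun r : ℝ => energy m k * (x + r • v).1 - inner ℝ k (x + r • v).2) =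
        fun r : ℝ => (energy m k * x.1 - inner ℝ k x.2)
          + r * (energy m k * v.1 - inner ℝ k v.2) := by
      funext r
      simp [inner_add_right, inner_smul_right]
      ring
    rw [e]
    simpa using ((hasDerivAt_id r).mul_const (energy m k * v.1 - inner ℝ k v.2)).const_add
      (energy m k * x.1 - inner ℝ k x.2)
  have h2 := (h1.ofReal_comp.const_mul Complex.I).cexp
  unfold planeWave
  convert h2 using 1
  ring

theorem IsTest.fderiv_apply {g : Spacetime → ℝ} (hg : IsTest g) (v : Spacetime) :
    IsTest fun x => fderiv ℝ g x v :=
  ⟨(hg.1.fderiv_right (m := ∞) (by simp)).clm_apply contDiff_const, hg.2.fderiv_apply ℝ v⟩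

theorem IsTest.integrable_mul {g : Spacetime → ℝ} (hg : IsTest g) {F : Spacetime → ℂ}
    (hF : Continuous F) : Integrable fun x => F x * (g x : ℂ) := by
  refine Continuous.integrable_of_hasCompactSupport
    (hF.mul (Complex.continuous_ofReal.comp hg.1.continuous)) ?_
  exact (hg.2.comp_left (g := fun r : ℝ => (r : ℂ)) Complex.ofReal_zero).mul_left

/-- The Fourier transform of a test function on the mass shell. -/
def shellTransform (m : ℝ) (g : Spacetime → ℝ) (k : Momentum) : ℂ :=
  ∫ x : Spacetime, planeWave m k x * (g x : ℂ)

theorem oneParticle_eq (m : ℝ) (g : Spacetime → ℝ) (k : Momentum) :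
    oneParticle m g k = ((Real.sqrt (2 * energy m k))⁻¹ : ℂ) * shellTransform m g k := rfl

/-- Integration by parts: derivatives of a test function become factors of momentum. -/
theorem shellTransform_fderiv (m : ℝ) {g : Spacetime → ℝ} (hg : IsTest g) (v : Spacetime)
    (k : Momentum) :
    shellTransform m (fun x => fderiv ℝ g x v) k =
      -(Complex.I * (energy m k * v.1 - inner ℝ k v.2 : ℝ)) * shellTransform m g k := by
  set q : ℂ := Complex.I * (energy m k * v.1 - inner ℝ k v.2 : ℝ)
  have hp := continuous_planeWave_right m k
  have : (volume : Measure Spacetime).IsAddHaarMeasure :=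
    inferInstanceAs ((volume : Measure ℝ).prod (volume : Measure Momentum)).IsAddHaarMeasure
  have h := integral_bilinear_hasLineDerivAt_right_eq_neg_left_of_integrable
    (μ := (volume : Measure Spacetime)) (f := planeWave m k) (f' := fun x => q * planeWave m k x)
    (g := fun x => (g x : ℂ)) (g' := fun x => ((fderiv ℝ g x v : ℝ) : ℂ)) (v := v)
    (B := ContinuousLinearMap.mul ℝ ℂ)
    (hg.integrable_mul (continuous_const.mul hp)) ((hg.fderiv_apply v).integrable_mul hp)
    (hg.integrable_mul hp)
    (fun x _ => by simpa [HasLineDerivAt, q] using hasDerivAt_planeWave_line m k x v 0)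
    (fun x _ => (((hg.1.differentiable (by simp)) x).hasFDerivAt.hasLineDerivAt v).ofReal_comp)
  simp only [ContinuousLinearMap.mul_apply'] at h
  rw [shellTransform, h, shellTransform, neg_mul, ← integral_const_mul]
  simp only [mul_assoc]

theorem norm_shellTransform_le (m : ℝ) (g : Spacetime → ℝ) (k : Momentum) :
    ‖shellTransform m g k‖ ≤ ∫ x, |g x| := by
  refine (norm_integral_le_integral_norm _).trans_eq ?_
  simp [norm_planeWave]

/-- Two integrations by parts in each spatial direction bound the decay in momentum. -/
theorem shellTransform_decay (m : ℝ) {g : Spacetime → ℝ} (hg : IsTest g) :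
    ∃ C : ℝ, ∀ k, (1 + ‖k‖ ^ 2) * ‖shellTransform m g k‖ ≤ C := by
  let v : Fin 3 → Spacetime := fun i => (0, EuclideanSpace.single i 1)
  let g' : Fin 3 → Spacetime → ℝ := fun i x => fderiv ℝ (fun x => fderiv ℝ g x (v i)) x (v i)
  refine ⟨(∫ x, |g x|) + ∑ i, ∫ x, |g' i x|, fun k => ?_⟩
  have h : ∀ i, k i ^ 2 * ‖shellTransform m g k‖ ≤ ∫ x, |g' i x| := by
    intro i
    have h1 := shellTransform_fderiv m (hg.fderiv_apply (v i)) (v i) k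
    rw [shellTransform_fderiv m hg] at h1
    have h2 := norm_shellTransform_le m (g' i) k
    rw [h1] at h2
    simpa [v, EuclideanSpace.inner_single_right, ← mul_assoc, ← pow_two] using h2
  rw [EuclideanSpace.norm_sq_eq, add_mul, one_mul, Finset.sum_mul]
  refine add_le_add (norm_shellTransform_le m g k) (Finset.sum_le_sum fun i _ => ?_)
  simpa using h i

theorem continuous_shellTransform (m : ℝ) {g : Spacetime → ℝ} (hg : IsTest g) :
    Continuous (shellTransform m g) := by
  have hgc : Continuous g := hg.1.continuous
  have hpc := continuous_planeWave m
  have hcont : Continuous fun k : Momentum =>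
      ∫ x in tsupport g, planeWave m k x * (g x : ℂ) ∂(volume : Measure Spacetime) :=
    continuous_parametric_integral_of_continuous
      (hpc.mul (Complex.continuous_ofReal.comp (hgc.comp continuous_snd))) hg.2
  refine hcont.congr fun k => ?_
  refine setIntegral_eq_integral_of_forall_compl_eq_zero fun x hx => ?_
  simp [image_eq_zero_of_notMem_tsupport hx]

/-- Decay of the transform like `‖k‖⁻²` suffices, since `(1 + ‖k‖²)⁻²` is integrable in dimension
three and `ω` is bounded below by the mass. -/
theorem memLp_oneParticle {m : ℝ} (hm : 0 < m) {g : Spacetime → ℝ} (hg : IsTest g) :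
    MemLp (oneParticle m g) 2 momentumMeasure := by
  obtain ⟨C, hC⟩ := shellTransform_decay m hg
  have hmeas : AEStronglyMeasurable (oneParticle m g) momentumMeasure := by
    have h1 : Measurable fun k => Real.sqrt (2 * energy m k) :=
      ((continuous_energy m).measurable.const_mul 2).sqrt
    exact ((Complex.measurable_ofReal.comp h1).inv.mul
      (continuous_shellTransform m hg).measurable).aestronglyMeasurable
  rw [memLp_two_iff_integrable_sq_norm hmeas]
  have hint : Integrable (fun k : Momentum => (2 * m)⁻¹ * C ^ 2 * (1 + ‖k‖ ^ 2) ^ (-(4 : ℝ) / 2))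
      momentumMeasure := by
    refine (Integrable.smul_measure_nnreal ?_).const_mul _
    exact integrable_rpow_neg_one_add_norm_sq (by simp; norm_num)
  refine hint.mono' (hmeas.norm.pow 2) (Filter.Eventually.of_forall fun k => ?_)
  have hk : (0 : ℝ) < 1 + ‖k‖ ^ 2 := by positivity
  have he := energy_pos hm k
  have e1 : (1 + ‖k‖ ^ 2) ^ (-(4 : ℝ) / 2) = ((1 + ‖k‖ ^ 2) ^ 2)⁻¹ := by
    rw [show -(4 : ℝ) / 2 = -((2 : ℕ) : ℝ) by norm_num, Real.rpow_neg hk.le, Real.rpow_natCast]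
  have e2 : ‖oneParticle m g k‖ ^ 2 = (2 * energy m k)⁻¹ * ‖shellTransform m g k‖ ^ 2 := by
    rw [oneParticle_eq, norm_mul, mul_pow, norm_inv, Complex.norm_real, inv_pow, Real.norm_eq_abs,
      sq_abs, Real.sq_sqrt (by positivity)]
  have h1 : ‖shellTransform m g k‖ ^ 2 ≤ C ^ 2 * ((1 + ‖k‖ ^ 2) ^ 2)⁻¹ := by
    rw [← div_eq_mul_inv, le_div_iff₀ (by positivity), mul_comm, ← mul_pow]
    exact pow_le_pow_left₀ (by positivity) (hC k) 2
  have h2 : (2 * energy m k)⁻¹ ≤ (2 * m)⁻¹ :=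
    inv_anti₀ (by positivity) (by linarith [le_energy m k])
  rw [e1, e2, Real.norm_of_nonneg (by positivity), mul_assoc]
  exact mul_le_mul h2 h1 (by positivity) (by positivity)

/-! ### The momentum shell and its mode function -/

instance : IsFiniteMeasureOnCompacts momentumMeasure := by
  unfold momentumMeasure
  infer_instance

instance : momentumMeasure.IsNegInvariant := by
  refine ⟨?_⟩
  ext s hs
  simp [momentumMeasure, Measure.neg_apply]

/-- The momenta with `m / 2 ≤ ‖k‖ ≤ m`. The upper bound keeps the sum of two energies at
most `2√2 m`, the lower bound keeps the product of two energies above `m²` by a fixed factor. -/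
def shell (m : ℝ) : Set Momentum := {k | m / 2 ≤ ‖k‖ ∧ ‖k‖ ≤ m}

/-- The restriction of `d³k / (2π)³` to the shell. -/
abbrev shellMeasure (m : ℝ) : Measure Momentum := momentumMeasure.restrict (shell m)

theorem isClosed_shell (m : ℝ) : IsClosed (shell m) :=
  (isClosed_le continuous_const continuous_norm).inter (isClosed_le continuous_norm continuous_const)

theorem isCompact_shell (m : ℝ) : IsCompact (shell m) :=
  (isCompact_closedBall (0 : Momentum) m).of_isClosed_subset (isClosed_shell m) fun k hk => by
    simpa using hk.2

theorem measurableSet_shell (m : ℝ) : MeasurableSet (shell m) := (isClosed_shell m).measurableSet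

instance (m : ℝ) : IsFiniteMeasure (shellMeasure m) :=
  isFiniteMeasure_restrict.2 (isCompact_shell m).measure_ne_top

theorem integrable_shell {E : Type*} [NormedAddCommGroup E] (m : ℝ) {F : Momentum → E}
    (hF : Continuous F) : Integrable F (shellMeasure m) :=
  hF.continuousOn.integrableOn_compact (isCompact_shell m)

theorem ae_shell (m : ℝ) : ∀ᵐ k ∂shellMeasure m, k ∈ shell m :=
  ae_restrict_mem (measurableSet_shell m)

theorem energy_le {m : ℝ} (hm : 0 < m) {k : Momentum} (hk : k ∈ shell m) :
    energy m k ≤ Real.sqrt 2 * m := by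
  rw [← Real.sqrt_sq hm.le, energy, ← Real.sqrt_mul (by norm_num), Real.sqrt_sq hm.le]
  exact Real.sqrt_le_sqrt (by nlinarith [hk.2, norm_nonneg k])

theorem energy_le' {m : ℝ} (hm : 0 < m) {k : Momentum} (hk : k ∈ shell m) :
    energy m k ≤ 3 / 2 * m :=
  (energy_le hm hk).trans (mul_le_mul_of_nonneg_right
    ((Real.sqrt_le_left (by norm_num)).2 (by norm_num)) hm.le)

theorem energy_mul_energy_ge {m : ℝ} (hm : 0 < m) {k l : Momentum} (hk : k ∈ shell m)
    (hl : l ∈ shell m) : 5 / 4 * m ^ 2 ≤ energy m k * energy m l := by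
  have h : ∀ {k : Momentum}, k ∈ shell m → Real.sqrt (5 / 4 * m ^ 2) ≤ energy m k := fun hk =>
    Real.sqrt_le_sqrt (by nlinarith [hk.1])
  calc 5 / 4 * m ^ 2 = Real.sqrt (5 / 4 * m ^ 2) * Real.sqrt (5 / 4 * m ^ 2) :=
        (Real.mul_self_sqrt (by positivity)).symm
    _ ≤ _ := mul_le_mul (h hk) (h hl) (Real.sqrt_nonneg _) (energy_pos hm k).le

/-- The measure of the shell. -/
def shellVolume (m : ℝ) : ℝ := momentumMeasure.real (shell m)

theorem shellMeasure_real_univ (m : ℝ) : (shellMeasure m).real univ = shellVolume m := by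
  simp [shellVolume]

open scoped Pointwise in
/-- The shells are dilations of each other. -/
theorem shellVolume_eq {m : ℝ} (hm : 0 < m) : shellVolume m = m ^ 3 * shellVolume 1 := by
  have h : shell m = m • shell 1 := by
    ext k
    rw [mem_smul_set_iff_inv_smul_mem₀ hm.ne']
    simp only [shell, mem_ofPred_eq, norm_smul, norm_inv, Real.norm_eq_abs, abs_of_pos hm]
    rw [← div_eq_inv_mul, div_le_div_iff₀ (by norm_num) hm, div_le_iff₀ hm, one_mul,
      div_le_iff₀ (by norm_num)]
  unfold shellVolume Measure.real momentumMeasure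
  rw [h, Measure.smul_apply, Measure.smul_apply, Measure.addHaar_smul]
  have h3 : (ENNReal.ofReal (m ^ 3)).toReal = m ^ 3 := ENNReal.toReal_ofReal (by positivity)
  simp [abs_of_pos hm, ENNReal.toReal_mul, ENNReal.smul_def, h3]
  ring

theorem shellVolume_one_pos : 0 < shellVolume 1 := by
  have hb : Metric.ball (EuclideanSpace.single (0 : Fin 3) (3 / 4 : ℝ)) (1 / 4) ⊆ shell 1 := by
    intro k hk
    rw [mem_ball_iff_norm] at hk
    have h0 : ‖EuclideanSpace.single (0 : Fin 3) (3 / 4 : ℝ)‖ = 3 / 4 := by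
      refine (PiLp.norm_single 2 (fun _ : Fin 3 => ℝ) 0 (3 / 4)).trans ?_
      norm_num
    have h1 := norm_sub_norm_le (EuclideanSpace.single (0 : Fin 3) (3 / 4 : ℝ)) k
    have h2 := norm_sub_norm_le k (EuclideanSpace.single (0 : Fin 3) (3 / 4 : ℝ))
    rw [norm_sub_rev] at h1
    constructor <;> linarith
  refine ENNReal.toReal_pos (fun h => ?_) (isCompact_shell 1).measure_ne_top
  have h1 := measure_mono_null hb h
  unfold momentumMeasure at h1
  rw [Measure.smul_apply, ENNReal.smul_def, smul_eq_mul, mul_eq_zero] at h1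
  rcases h1 with h1 | h1
  · have : (0 : ℝ) < ((2 * Real.pi) ^ 3)⁻¹ := by positivity
    simp at h1
    exact absurd h1 (not_le.2 (by positivity))
  · exact absurd h1 (Metric.measure_ball_pos _ _ (by norm_num)).ne'

/-- The one-particle wave function `√(2 ω)` on the shell, `0` elsewhere. -/
def profile (m : ℝ) (k : Momentum) : ℂ :=
  (shell m).indicator (fun k => ((Real.sqrt (2 * energy m k) : ℝ) : ℂ)) k

theorem memLp_profile (m : ℝ) : MemLp (profile m) 2 momentumMeasure := by
  have hc : Continuous fun k => ((Real.sqrt (2 * energy m k) : ℝ) : ℂ) := by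
    have := continuous_energy m
    fun_prop
  have : MemLp (fun k => ((Real.sqrt (2 * energy m k) : ℝ) : ℂ)) 2 (shellMeasure m) := by
    rw [memLp_two_iff_integrable_sq_norm hc.aestronglyMeasurable]
    exact integrable_shell m (hc.norm.pow 2)
  exact (memLp_indicator_iff_restrict (measurableSet_shell m)).2 this

/-- The norm square of the profile. -/
def profileNormSq (m : ℝ) : ℝ := ∫ k, 2 * energy m k ∂shellMeasure m

theorem integral_mul_profile (m : ℝ) (F : Momentum → ℂ) :
    ∫ k, F k * profile m k ∂momentumMeasure =
      ∫ k, F k * (Real.sqrt (2 * energy m k) : ℝ) ∂shellMeasure m := by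
  rw [← integral_indicator (measurableSet_shell m)]
  refine integral_congr_ae (Filter.Eventually.of_forall fun k => ?_)
  by_cases hk : k ∈ shell m <;> simp [profile, hk]

theorem pairing_profile_self {m : ℝ} (hm : 0 < m) :
    pairing (profile m) (profile m) = profileNormSq m := by
  rw [pairing, integral_mul_profile, profileNormSq, ← integral_complex_ofReal]
  refine integral_congr_ae ?_
  filter_upwards [ae_shell m] with k hk
  have he := energy_pos hm k
  simp only [profile, indicator_of_mem hk, Complex.conj_ofReal]
  rw [← Complex.ofReal_mul, Real.mul_self_sqrt (by positivity)]

theorem profileNormSq_nonneg {m : ℝ} (hm : 0 < m) : 0 ≤ profileNormSq m :=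
  integral_nonneg fun k => (mul_pos two_pos (energy_pos hm k)).le

theorem profileNormSq_le {m : ℝ} (hm : 0 < m) : profileNormSq m ≤ 3 * m * shellVolume m := by
  have hc := continuous_energy m
  calc profileNormSq m ≤ ∫ _, 3 * m ∂shellMeasure m := by
        refine integral_mono_ae (integrable_shell m (by fun_prop)) (integrable_const _) ?_
        filter_upwards [ae_shell m] with k hk
        linarith [energy_le' hm hk]
    _ = 3 * m * shellVolume m := by
        rw [integral_const, shellMeasure_real_univ, smul_eq_mul]
        ring

/-- The positive frequency solution `∫ d³k/(2π)³ e^{-i(ω t - k·x)}` of the Klein-Gordon equation,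
with integration over the shell. -/
def mode (m : ℝ) (x : Spacetime) : ℂ := ∫ k, conj (planeWave m k x) ∂shellMeasure m

/-- The inner product of momentum space as a continuous bilinear form. -/
def innerForm : Momentum →L[ℝ] Momentum →L[ℝ] ℝ := innerSL ℝ

/-- The bilinear form `(2π)⁻¹ (v₀ w₀ - v·w)`. -/
def minkowskiForm : Spacetime →L[ℝ] Spacetime →L[ℝ] ℝ :=
  (2 * Real.pi)⁻¹ • ((ContinuousLinearMap.mul ℝ ℝ).bilinearComp
      (ContinuousLinearMap.fst ℝ ℝ Momentum) (ContinuousLinearMap.fst ℝ ℝ Momentum)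
    - innerForm.bilinearComp
      (ContinuousLinearMap.snd ℝ ℝ Momentum) (ContinuousLinearMap.snd ℝ ℝ Momentum))

/-- The mode function is smooth, being the Fourier transform of a compactly supported measure on
the mass shell. -/
theorem contDiff_mode (m : ℝ) : ContDiff ℝ ∞ (mode m) := by
  have hc := continuous_energy m
  have hc' : Continuous fun k : Momentum => (energy m k, k) := by fun_prop
  have h := VectorFourier.contDiff_fourierIntegral (N := ⊤) minkowskiForm
    (μ := (shellMeasure m).map fun k => (energy m k, k)) (f := fun _ => (1 : ℂ)) fun n _ => by
      rw [integrable_map_measure (by fun_prop) (by fun_prop)]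
      exact integrable_shell m (by simp only [Function.comp_def]; fun_prop)
  suffices e : mode m = VectorFourier.fourierIntegral Real.fourierChar
      ((shellMeasure m).map fun k => (energy m k, k)) minkowskiForm.toLinearMap₁₂
      fun _ => (1 : ℂ) by
    rw [e]
    exact h
  funext x
  have hm : AEStronglyMeasurable
      (fun v : Spacetime => Real.fourierChar (-(minkowskiForm v x)) • (1 : ℂ))
      ((shellMeasure m).map fun k => (energy m k, k)) := by
    refine Continuous.aestronglyMeasurable ?_
    fun_prop
  rw [VectorFourier.fourierIntegral]
  refine Eq.trans ?_ (integral_map hc'.measurable.aemeasurable hm).symm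
  refine integral_congr_ae (Filter.Eventually.of_forall fun k => ?_)
  simp only [planeWave, Circle.smul_def, Real.fourierChar_apply, minkowskiForm]
  rw [← Complex.exp_conj]
  simp
  congr 1
  field_simp
  rfl

theorem continuous_mode (m : ℝ) : Continuous (mode m) := (contDiff_mode m).continuous

/-- Smearing the mode function with a test function gives the product of the one-particle vector of
the test function with the profile. -/
theorem pairing_oneParticle_profile {m : ℝ} (hm : 0 < m) {g : Spacetime → ℝ} (hg : IsTest g) :
    pairing (oneParticle m g) (profile m) = ∫ x, mode m x * (g x : ℂ) := by
  have h1 : pairing (oneParticle m g) (profile m) =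
      ∫ k, (∫ x : Spacetime, conj (planeWave m k x) * (g x : ℂ)) ∂shellMeasure m := by
    rw [pairing, integral_mul_profile]
    refine integral_congr_ae (Filter.Eventually.of_forall fun k => ?_)
    have he : ((Real.sqrt (2 * energy m k) : ℝ) : ℂ) ≠ 0 :=
      Complex.ofReal_ne_zero.2 (Real.sqrt_pos.2 (by linarith [energy_pos hm k])).ne'
    simp only [oneParticle_eq, shellTransform, map_mul, map_inv₀, Complex.conj_ofReal,
      ← integral_conj]
    field_simp
  rw [h1, integral_integral_swap]
  · refine integral_congr_ae (Filter.Eventually.of_forall fun x => ?_)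
    simp only [mode, integral_mul_const]
  · have hg1 : Integrable fun x => (g x : ℂ) := by
      simpa using hg.integrable_mul (F := fun _ => 1) continuous_const
    have h2 : Integrable (fun p : Momentum × Spacetime => (1 : ℂ) * (g p.2 : ℂ))
        ((shellMeasure m).prod volume) := (integrable_const (1 : ℂ)).mul_prod hg1
    refine h2.mono ?_ (Filter.Eventually.of_forall fun p => ?_)
    · have hc := continuous_planeWave m
      have hgc := hg.1.continuous
      refine Continuous.aestronglyMeasurable ?_
      simp only [Function.uncurry_def]
      exact (Complex.continuous_conj.comp hc).mul
        (Complex.continuous_ofReal.comp (hgc.comp continuous_snd))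
    · simp [Function.uncurry_def, norm_planeWave]

/-- The derivative of the mode function at `x` in direction `v`. -/
def modeDeriv (m : ℝ) (v x : Spacetime) : ℂ :=
  ∫ k, conj (Complex.I * (energy m k * v.1 - inner ℝ k v.2 : ℝ) * planeWave m k x) ∂shellMeasure m

theorem hasDerivAt_mode_line (m : ℝ) (v x : Spacetime) :
    HasDerivAt (fun r : ℝ => mode m (x + r • v)) (modeDeriv m v x) 0 := by
  have hc := continuous_energy m
  have hq : Continuous fun k : Momentum => energy m k * v.1 - inner ℝ k v.2 := by fun_prop
  have hp : ∀ y, Continuous fun k => planeWave m k y := fun y => by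
    unfold planeWave
    fun_prop
  have h := hasDerivAt_integral_of_dominated_loc_of_deriv_le (μ := shellMeasure m) (x₀ := (0 : ℝ))
    (F := fun r k => conj (planeWave m k (x + r • v)))
    (F' := fun r k => conj (Complex.I * (energy m k * v.1 - inner ℝ k v.2 : ℝ)
      * planeWave m k (x + r • v)))
    (bound := fun k => |energy m k * v.1 - inner ℝ k v.2|) Filter.univ_mem
    (Filter.Eventually.of_forall fun r =>
      (Complex.continuous_conj.comp (hp _)).aestronglyMeasurable)
    (integrable_shell m (Complex.continuous_conj.comp (hp _)))
    (Complex.continuous_conj.comp ((continuous_const.mul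
      (Complex.continuous_ofReal.comp hq)).mul (hp _))).aestronglyMeasurable
    (Filter.Eventually.of_forall fun k r _ => by
      rw [RCLike.norm_conj, norm_mul, norm_mul, norm_planeWave, Complex.norm_I, Complex.norm_real]
      simp)
    (integrable_shell m hq.abs)
    (Filter.Eventually.of_forall fun k r _ => (hasDerivAt_planeWave_line m k x v r).star)
  simp only [zero_smul, add_zero] at h
  exact h.2

/-- By reflection symmetry of the shell, the mode function has vanishing spatial gradient at the
spatial origin. -/
theorem modeDeriv_space (m t : ℝ) (e : Momentum) : modeDeriv m (0, e) (t, 0) = 0 := by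
  have h : modeDeriv m (0, e) (t, 0) = -modeDeriv m (0, e) (t, 0) := by
    unfold modeDeriv
    rw [← integral_indicator (measurableSet_shell m)]
    conv_lhs => rw [← integral_neg_eq_self]
    rw [← integral_neg]
    refine integral_congr_ae (Filter.Eventually.of_forall fun k => ?_)
    have hs : -k ∈ shell m ↔ k ∈ shell m := by simp [shell]
    by_cases hk : k ∈ shell m <;> simp [hs, hk, planeWave, energy]
  exact self_eq_neg.1 h

/-! ### The normal ordered two-point function -/

/-- The vector `a Ω + c b ⊗ b`, with `b` the profile. -/
def shellState (m a c : ℝ) : Fock := pairState a c (memLp_profile m)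

/-- The smooth kernel of the normal ordered two-point function of `shellState m a c`. -/
def shellKernel (m a c : ℝ) (p : Spacetime × Spacetime) : ℂ :=
  (Real.sqrt 2 * a * c : ℝ) * (mode m p.1 * mode m p.2 + conj (mode m p.1) * conj (mode m p.2))
  + (2 * c ^ 2 * profileNormSq m : ℝ)
    * (conj (mode m p.1) * mode m p.2 + mode m p.1 * conj (mode m p.2))

theorem norm_shellState_sq {m : ℝ} (hm : 0 < m) (a c : ℝ) :
    ‖shellState m a c‖ ^ 2 = a ^ 2 + c ^ 2 * profileNormSq m ^ 2 := by
  have h := inner_pairState a c (memLp_profile m)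
  change inner ℂ (shellState m a c) (shellState m a c) = _ at h
  rw [inner_self_eq_norm_sq_to_K, pairing_profile_self hm] at h
  apply Complex.ofReal_injective
  push_cast
  exact h

theorem fieldGraph_shellState {m : ℝ} (hm : 0 < m) (a c : ℝ) {g : Spacetime → ℝ} (hg : IsTest g) :
    FieldGraph m g (shellState m a c)
      (fieldState a c (memLp_profile m) (memLp_oneParticle hm hg)) :=
  fieldState_graph a c (memLp_profile m) (memLp_oneParticle hm hg)

theorem contDiff_shellKernel (m a c : ℝ) : ContDiff ℝ ∞ (shellKernel m a c) := by
  have h := contDiff_mode m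
  have h1 : ContDiff ℝ ∞ fun p : Spacetime × Spacetime => mode m p.1 := h.comp contDiff_fst
  have h2 : ContDiff ℝ ∞ fun p : Spacetime × Spacetime => mode m p.2 := h.comp contDiff_snd
  have hs : ContDiff ℝ ∞ fun z : ℂ => conj z := Complex.conjCLE.contDiff
  have h3 := hs.comp h1
  have h4 := hs.comp h2
  exact (contDiff_const.mul ((h1.mul h2).add (h3.mul h4))).add
    (contDiff_const.mul ((h3.mul h2).add (h1.mul h4)))

/-- Smearing of a linear combination of the mode function and its conjugate. -/
theorem integral_mode_add_conj (m : ℝ) {g : Spacetime → ℝ} (hg : IsTest g) (α β : ℂ) :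
    ∫ x, (α * mode m x + β * conj (mode m x)) * (g x : ℂ) =
      α * (∫ x, mode m x * (g x : ℂ)) + β * conj (∫ x, mode m x * (g x : ℂ)) := by
  have hc := continuous_mode m
  have h1 := (hg.integrable_mul hc).const_mul α
  have h2 := (hg.integrable_mul (Complex.continuous_conj.comp hc)).const_mul β
  rw [← integral_conj, ← integral_const_mul, ← integral_const_mul]
  simp only [map_mul, Complex.conj_ofReal]
  refine Eq.trans ?_ (integral_add h1 h2)
  refine integral_congr_ae (Filter.Eventually.of_forall fun x => ?_)
  beta_reduce
  ring

/-- The vacuum part of the two-point function cancels by the commutation relations, and what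
remains is the smearing of a combination of products of mode functions. -/
theorem isWickKernel_shellKernel {m : ℝ} (hm : 0 < m) (a c : ℝ) :
    IsWickKernel m (shellState m a c) (shellKernel m a c) := by
  refine ⟨contDiff_shellKernel m a c, fun g h hg hh => ?_⟩
  have hn : ((‖shellState m a c‖ : ℝ) : ℂ) ^ 2 = (a : ℂ) ^ 2 + c ^ 2 * profileNormSq m ^ 2 := by
    exact_mod_cast norm_shellState_sq hm a c
  have hv : twoPoint m vacuum g h = pairing (oneParticle m g) (oneParticle m h) := by
    have e : vacuum = shellState m 1 0 := vacuum_eq_pairState _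
    rw [twoPoint, e, (fieldGraph_shellState hm 1 0 hg).field_eq,
      (fieldGraph_shellState hm 1 0 hh).field_eq, inner_fieldState]
    simp
  rw [hn, hv, twoPoint, (fieldGraph_shellState hm a c hg).field_eq,
    (fieldGraph_shellState hm a c hh).field_eq, inner_fieldState, pairing_profile_self hm,
    ← conj_pairing (oneParticle m g) (profile m), ← conj_pairing (oneParticle m h) (profile m),
    pairing_oneParticle_profile hm hg, pairing_oneParticle_profile hm hh]
  set G : ℂ := ∫ x, mode m x * (g x : ℂ) with hG
  set H : ℂ := ∫ x, mode m x * (h x : ℂ) with hH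
  have h1 : ∀ y, ∫ x, shellKernel m a c (x, y) * (g x : ℂ) =
      ((Real.sqrt 2 * a * c : ℝ) * G + (2 * c ^ 2 * profileNormSq m : ℝ) * conj G) * mode m y
      + ((Real.sqrt 2 * a * c : ℝ) * conj G + (2 * c ^ 2 * profileNormSq m : ℝ) * G)
        * conj (mode m y) := by
    intro y
    have e := integral_mode_add_conj m hg
      ((Real.sqrt 2 * a * c : ℝ) * mode m y + (2 * c ^ 2 * profileNormSq m : ℝ) * conj (mode m y))
      ((Real.sqrt 2 * a * c : ℝ) * conj (mode m y) + (2 * c ^ 2 * profileNormSq m : ℝ) * mode m y)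
    rw [← hG] at e
    refine (integral_congr_ae (Filter.Eventually.of_forall fun x => ?_)).trans (e.trans ?_)
    · simp only [shellKernel]
      ring
    · ring
  simp_rw [h1]
  rw [integral_mode_add_conj m hh, ← hH]
  push_cast
  ring

theorem isHadamard_shellState {m : ℝ} (hm : 0 < m) (a c : ℝ) : IsHadamard m (shellState m a c) :=
  ⟨fun _ hg => ⟨_, fieldGraph_shellState hm a c hg⟩, _, isWickKernel_shellKernel hm a c⟩

theorem coincidenceDeriv_shellKernel (m a c : ℝ) (v x : Spacetime) :
    coincidenceDeriv (shellKernel m a c) v x =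
      (Real.sqrt 2 * a * c : ℝ) * (modeDeriv m v x ^ 2 + conj (modeDeriv m v x) ^ 2)
      + (2 * c ^ 2 * profileNormSq m : ℝ) * (2 * (conj (modeDeriv m v x) * modeDeriv m v x)) := by
  set C : ℂ := ((Real.sqrt 2 * a * c : ℝ) : ℂ)
  set D : ℂ := ((2 * c ^ 2 * profileNormSq m : ℝ) : ℂ)
  set d := modeDeriv m v x
  have hd : HasDerivAt (fun r : ℝ => mode m (x + r • v)) d 0 := hasDerivAt_mode_line m v x
  have hd' : HasDerivAt (fun r : ℝ => conj (mode m (x + r • v))) (conj d) 0 := hd.star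
  have h1 : ∀ y, deriv (fun r : ℝ => shellKernel m a c (x + r • v, y)) 0 =
      (C * d + D * conj d) * mode m y + (C * conj d + D * d) * conj (mode m y) := by
    intro y
    have h2 := (((hd.mul_const (mode m y)).add (hd'.mul_const (conj (mode m y)))).const_mul C).add
      (((hd'.mul_const (mode m y)).add (hd.mul_const (conj (mode m y)))).const_mul D)
    refine (HasDerivAt.deriv h2).trans ?_
    ring
  unfold coincidenceDeriv
  simp_rw [h1]
  refine (HasDerivAt.deriv ((hd.const_mul _).add (hd'.const_mul _))).trans ?_
  ring

/-- The energy density of `a Ω + c b ⊗ b` on the time axis: an interference term between vacuum and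
two-particle component, linear in `c`, and a nonnegative term, quadratic in `c`. -/
theorem energyDensity_shellState {m : ℝ} (hm : 0 < m) (a c t : ℝ) :
    energyDensity m (shellState m a c) (t, 0) =
      Real.sqrt 2 * a * c * (modeDeriv m (1, 0) (t, 0) ^ 2 + m ^ 2 * mode m (t, 0) ^ 2).re
      + 2 * c ^ 2 * profileNormSq m
        * (‖modeDeriv m (1, 0) (t, 0)‖ ^ 2 + m ^ 2 * ‖mode m (t, 0)‖ ^ 2) := by
  unfold energyDensity
  rw [(isWickKernel_shellKernel hm a c).wickKernel_eq]
  simp only [coincidenceDeriv_shellKernel, modeDeriv_space, shellKernel]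
  generalize modeDeriv m (1, 0) (t, 0) = d
  generalize mode m (t, 0) = p
  have e : (1 / 2 : ℂ) * ((Real.sqrt 2 * a * c : ℝ) * (d ^ 2 + conj d ^ 2)
      + (2 * c ^ 2 * profileNormSq m : ℝ) * (2 * (conj d * d))
      + ∑ _i : Fin 3, ((Real.sqrt 2 * a * c : ℝ) * (0 ^ 2 + conj (0 : ℂ) ^ 2)
        + (2 * c ^ 2 * profileNormSq m : ℝ) * (2 * (conj (0 : ℂ) * 0)))
      + (m : ℂ) ^ 2 * ((Real.sqrt 2 * a * c : ℝ) * (p * p + conj p * conj p)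
        + (2 * c ^ 2 * profileNormSq m : ℝ) * (conj p * p + p * conj p))) =
      (Real.sqrt 2 * a * c : ℝ) * (((d ^ 2 + m ^ 2 * p ^ 2) + conj (d ^ 2 + m ^ 2 * p ^ 2)) / 2)
      + (2 * c ^ 2 * profileNormSq m : ℝ) * (conj d * d + m ^ 2 * (conj p * p)) := by
    simp
    ring
  rw [e, ← Complex.re_eq_add_conj, Complex.conj_mul', Complex.conj_mul']
  norm_cast

/-! ### Time averages -/

/-- The negative frequency phase `e^{-iωt}`. -/
def phase (m : ℝ) (k : Momentum) (t : ℝ) : ℂ := conj (planeWave m k (t, 0))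

theorem norm_phase (m : ℝ) (k : Momentum) (t : ℝ) : ‖phase m k t‖ = 1 := by
  rw [phase, RCLike.norm_conj, norm_planeWave]

theorem continuous_phase (m : ℝ) {X : Type*} [TopologicalSpace X] {k : X → Momentum} {t : X → ℝ}
    (hk : Continuous k) (ht : Continuous t) : Continuous fun p => phase m (k p) (t p) := by
  have hc := continuous_energy m
  unfold phase planeWave
  fun_prop

theorem phase_mul_phase (m : ℝ) (k l : Momentum) (t : ℝ) :
    phase m k t * phase m l t =
      Complex.exp (-Complex.I * (energy m k + energy m l : ℝ) * t) := by
  simp only [phase, planeWave, ← Complex.exp_conj, ← Complex.exp_add]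
  congr 1
  simp
  ring

theorem mode_time (m t : ℝ) : mode m (t, 0) = ∫ k, phase m k t ∂shellMeasure m := rfl

theorem modeDeriv_time (m t : ℝ) :
    modeDeriv m (1, 0) (t, 0) = ∫ k, -Complex.I * energy m k * phase m k t ∂shellMeasure m := by
  unfold modeDeriv phase
  refine integral_congr_ae (Filter.Eventually.of_forall fun k => ?_)
  simp

theorem continuous_mode_time (m : ℝ) : Continuous fun t : ℝ => mode m (t, 0) :=
  (continuous_mode m).comp (by fun_prop)

theorem continuous_modeDeriv_time (m : ℝ) : Continuous fun t : ℝ => modeDeriv m (1, 0) (t, 0) := by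
  simp_rw [modeDeriv_time]
  have hc := continuous_energy m
  have hp : Continuous fun p : ℝ × Momentum => phase m p.2 p.1 :=
    continuous_phase m continuous_snd continuous_fst
  refine continuous_parametric_integral_of_continuous
    (f := fun (t : ℝ) k => -Complex.I * energy m k * phase m k t) ?_ (isCompact_shell m)
  simp only [Function.uncurry_def]
  exact (by fun_prop : Continuous fun p : ℝ × Momentum => -Complex.I * (energy m p.2 : ℂ)).mul hp

theorem norm_mode_time_le (m t : ℝ) : ‖mode m (t, 0)‖ ≤ shellVolume m := by
  rw [mode_time, ← one_mul (shellVolume m), ← shellMeasure_real_univ]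
  exact norm_integral_le_of_norm_le_const
    (Filter.Eventually.of_forall fun k => (norm_phase m k t).le)

theorem norm_modeDeriv_time_le {m : ℝ} (hm : 0 < m) (t : ℝ) :
    ‖modeDeriv m (1, 0) (t, 0)‖ ≤ 3 / 2 * m * shellVolume m := by
  rw [modeDeriv_time, ← shellMeasure_real_univ]
  refine norm_integral_le_of_norm_le_const ?_
  filter_upwards [ae_shell m] with k hk
  rw [norm_mul, norm_phase, norm_mul, norm_neg, Complex.norm_I, Complex.norm_real,
    Real.norm_of_nonneg (energy_pos hm k).le]
  simpa using energy_le' hm hk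

/-- The product measure on pairs of shell momenta. -/
abbrev shellPairs (m : ℝ) : Measure (Momentum × Momentum) := (shellMeasure m).prod (shellMeasure m)

/-- The weight `ω ω' - m²`. -/
def pairWeight (m : ℝ) (z : Momentum × Momentum) : ℝ := energy m z.1 * energy m z.2 - m ^ 2

theorem continuous_pairWeight (m : ℝ) : Continuous (pairWeight m) := by
  have := continuous_energy m
  unfold pairWeight
  fun_prop

theorem integrable_pairWeight (m : ℝ) : Integrable (pairWeight m) (shellPairs m) :=
  ((integrable_shell m (continuous_energy m)).mul_prod
    (integrable_shell m (continuous_energy m))).sub (integrable_const _)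

/-- The interference term as a superposition of oscillations with frequencies `ω + ω'`. -/
theorem interference_eq (m t : ℝ) :
    modeDeriv m (1, 0) (t, 0) ^ 2 + m ^ 2 * mode m (t, 0) ^ 2 =
      ∫ z, -(pairWeight m z : ℂ) * (phase m z.1 t * phase m z.2 t) ∂shellPairs m := by
  have hc := continuous_energy m
  have hp : Continuous fun k => phase m k t := continuous_phase m continuous_id continuous_const
  have i1 := integrable_shell m hp
  have i2 : Integrable (fun k => -Complex.I * energy m k * phase m k t) (shellMeasure m) :=
    integrable_shell m
      ((by fun_prop : Continuous fun k => -Complex.I * (energy m k : ℂ)).mul hp)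
  rw [modeDeriv_time, mode_time, pow_two, pow_two (∫ k, phase m k t ∂shellMeasure m),
    ← integral_prod_mul, ← integral_prod_mul, ← integral_const_mul,
    ← integral_add (i2.mul_prod i2) ((i1.mul_prod i1).const_mul _)]
  refine integral_congr_ae (Filter.Eventually.of_forall fun z => ?_)
  simp only [pairWeight]
  push_cast
  linear_combination
    (energy m z.1 * energy m z.2 * phase m z.1 t * phase m z.2 t : ℂ) * Complex.I_sq

theorem integrable_interference (m : ℝ) {f : ℝ → ℝ} (hc : Continuous f)
    (hs : HasCompactSupport f) :
    Integrable (fun p : ℝ × (Momentum × Momentum) =>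
      -(pairWeight m p.2 : ℂ) * (phase m p.2.1 p.1 * phase m p.2.2 p.1) * (f p.1 : ℂ))
      (volume.prod (shellPairs m)) := by
  have h : Integrable (fun p : ℝ × (Momentum × Momentum) => f p.1 * pairWeight m p.2)
      (volume.prod (shellPairs m)) :=
    (hc.integrable_of_hasCompactSupport hs).mul_prod (integrable_pairWeight m)
  have hw := continuous_pairWeight m
  have hp1 : Continuous fun p : ℝ × (Momentum × Momentum) => phase m p.2.1 p.1 :=
    continuous_phase m (by fun_prop) continuous_fst
  have hp2 : Continuous fun p : ℝ × (Momentum × Momentum) => phase m p.2.2 p.1 :=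
    continuous_phase m (by fun_prop) continuous_fst
  refine h.mono (Continuous.aestronglyMeasurable (by fun_prop))
    (Filter.Eventually.of_forall fun p => ?_)
  simp only [norm_mul, norm_neg, norm_phase, Complex.norm_real]
  rw [mul_one, mul_one, mul_comm]

theorem integral_interference (m : ℝ) {f : ℝ → ℝ} (hc : Continuous f)
    (hs : HasCompactSupport f) :
    ∫ t : ℝ, (modeDeriv m (1, 0) (t, 0) ^ 2 + m ^ 2 * mode m (t, 0) ^ 2) * (f t : ℂ) =
      ∫ z, -(pairWeight m z : ℂ) * fourier f (energy m z.1 + energy m z.2) ∂shellPairs m := by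
  have h := integrable_interference m hc hs
  simp_rw [interference_eq, ← integral_mul_const]
  rw [integral_integral_swap h]
  refine integral_congr_ae (Filter.Eventually.of_forall fun z => ?_)
  simp only [fourier, phase_mul_phase, mul_assoc, integral_const_mul]

/-- The interference term averages to a negative number, since the weight `ω ω' - m²` is positive on
the shell and `f` has a Fourier transform that is bounded below on `[2 m, 2√2 m]`. -/
theorem integral_interference_re_le {m : ℝ} (hm : 0 < m) {f : ℝ → ℝ} (hc : Continuous f)
    (hs : HasCompactSupport f) {P : ℝ} (hP : 0 ≤ P)
    (hf : ∀ u, 2 * m ≤ u → u ≤ 2 * Real.sqrt 2 * m → P ≤ (fourier f u).re) :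
    (∫ t : ℝ, (modeDeriv m (1, 0) (t, 0) ^ 2 + m ^ 2 * mode m (t, 0) ^ 2) * (f t : ℂ)).re ≤
      -(m ^ 2 / 4 * P * shellVolume m ^ 2) := by
  have hi : Integrable (fun z => -(pairWeight m z : ℂ) *
      fourier f (energy m z.1 + energy m z.2)) (shellPairs m) := by
    refine (integrable_interference m hc hs).integral_prod_right.congr
      (Filter.Eventually.of_forall fun z => ?_)
    simp only [fourier, phase_mul_phase, mul_assoc, integral_const_mul]
  have hre : (∫ z, -(pairWeight m z : ℂ) * fourier f (energy m z.1 + energy m z.2)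
      ∂shellPairs m).re = ∫ z, (-(pairWeight m z : ℂ) *
        fourier f (energy m z.1 + energy m z.2)).re ∂shellPairs m := (integral_re hi).symm
  rw [integral_interference m hc hs, hre]
  calc _ ≤ ∫ _, -(m ^ 2 / 4 * P) ∂shellPairs m := by
        refine integral_mono_ae hi.re (integrable_const _) ?_
        filter_upwards [Measure.quasiMeasurePreserving_fst.ae (ae_shell m),
          Measure.quasiMeasurePreserving_snd.ae (ae_shell m)] with z h1 h2
        have hu := hf (energy m z.1 + energy m z.2)
          (by linarith [le_energy m z.1, le_energy m z.2])
          (by linarith [energy_le hm h1, energy_le hm h2])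
        have hw : m ^ 2 / 4 ≤ pairWeight m z := by
          have := energy_mul_energy_ge hm h1 h2
          unfold pairWeight
          linarith
        have := mul_le_mul hw hu hP ((by positivity : 0 ≤ m ^ 2 / 4).trans hw)
        simpa [← Complex.ofReal_neg] using this
    _ = -(m ^ 2 / 4 * P * shellVolume m ^ 2) := by
        have hV : (shellPairs m).real univ = shellVolume m * shellVolume m := by
          rw [← univ_prod_univ, measureReal_prod_prod, shellMeasure_real_univ]
        rw [integral_const, smul_eq_mul, hV]
        ring

/-- The upper bound for the averaged energy density of `a Ω + c b ⊗ b`, as a quadratic polynomial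
in `c`. -/
theorem integral_energyDensity_le {m : ℝ} (hm : 0 < m) {f : ℝ → ℝ} (hc : Continuous f)
    (hs : HasCompactSupport f) (hf0 : ∀ t, 0 ≤ f t) {P : ℝ} (hP : 0 ≤ P)
    (hf : ∀ u, 2 * m ≤ u → u ≤ 2 * Real.sqrt 2 * m → P ≤ (fourier f u).re)
    {a c : ℝ} (hac : 0 ≤ a * c) :
    ∫ t : ℝ, energyDensity m (shellState m a c) (t, 0) * f t ≤
      -(a * c * (m ^ 2 / 4 * P * shellVolume m ^ 2))
      + 24 * c ^ 2 * m ^ 3 * shellVolume m ^ 3 * ∫ t, f t := by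
  have hV : 0 ≤ shellVolume m := measureReal_nonneg
  have hI : Integrable f := hc.integrable_of_hasCompactSupport hs
  have hI0 : 0 ≤ ∫ t, f t := integral_nonneg hf0
  have hB := profileNormSq_nonneg hm
  have i1 : Integrable fun t : ℝ =>
      (modeDeriv m (1, 0) (t, 0) ^ 2 + m ^ 2 * mode m (t, 0) ^ 2) * (f t : ℂ) := by
    refine (integrable_interference m hc hs).integral_prod_left.congr
      (Filter.Eventually.of_forall fun t => ?_)
    simp only [integral_mul_const, interference_eq]
  have i2 : Integrable fun t : ℝ =>
      (‖modeDeriv m (1, 0) (t, 0)‖ ^ 2 + m ^ 2 * ‖mode m (t, 0)‖ ^ 2) * f t := by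
    have h1 := continuous_modeDeriv_time m
    have h2 := continuous_mode_time m
    exact Continuous.integrable_of_hasCompactSupport (by fun_prop) hs.mul_left
  have e1 : ∫ t : ℝ, ((modeDeriv m (1, 0) (t, 0) ^ 2 + m ^ 2 * mode m (t, 0) ^ 2)
      * (f t : ℂ)).re ≤ -(m ^ 2 / 4 * P * shellVolume m ^ 2) :=
    (integral_re i1).trans_le (integral_interference_re_le hm hc hs hP hf)
  have e2 : ∫ t : ℝ, (‖modeDeriv m (1, 0) (t, 0)‖ ^ 2 + m ^ 2 * ‖mode m (t, 0)‖ ^ 2) * f t ≤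
      4 * m ^ 2 * shellVolume m ^ 2 * ∫ t, f t := by
    rw [← integral_const_mul]
    refine integral_mono i2 (hI.const_mul _) fun t => ?_
    refine mul_le_mul_of_nonneg_right ?_ (hf0 t)
    have h1 := pow_le_pow_left₀ (norm_nonneg _) (norm_modeDeriv_time_le hm t) 2
    have h2 := mul_le_mul_of_nonneg_left
      (pow_le_pow_left₀ (norm_nonneg _) (norm_mode_time_le m t) 2) (sq_nonneg m)
    have h3 : 0 ≤ m ^ 2 * shellVolume m ^ 2 := by positivity
    calc _ ≤ (3 / 2 * m * shellVolume m) ^ 2 + m ^ 2 * shellVolume m ^ 2 := add_le_add h1 h2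
      _ ≤ 4 * m ^ 2 * shellVolume m ^ 2 := by linarith
  have e3 : ∫ t : ℝ, energyDensity m (shellState m a c) (t, 0) * f t =
      Real.sqrt 2 * a * c * (∫ t : ℝ, ((modeDeriv m (1, 0) (t, 0) ^ 2
        + m ^ 2 * mode m (t, 0) ^ 2) * (f t : ℂ)).re)
      + 2 * c ^ 2 * profileNormSq m * ∫ t : ℝ, (‖modeDeriv m (1, 0) (t, 0)‖ ^ 2
        + m ^ 2 * ‖mode m (t, 0)‖ ^ 2) * f t := by
    rw [← integral_const_mul, ← integral_const_mul]
    refine Eq.trans ?_ (integral_add (i1.re.const_mul (Real.sqrt 2 * a * c)) (i2.const_mul _))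
    refine integral_congr_ae (Filter.Eventually.of_forall fun t => ?_)
    simp only [energyDensity_shellState hm, Complex.re_mul_ofReal]
    ring
  rw [e3]
  refine add_le_add ?_ ?_
  · have hs2 : 1 ≤ Real.sqrt 2 := Real.one_le_sqrt.2 (by norm_num)
    have hac2 : a * c ≤ Real.sqrt 2 * a * c := by nlinarith
    have hM : 0 ≤ m ^ 2 / 4 * P * shellVolume m ^ 2 := by positivity
    have h1 := mul_le_mul_of_nonneg_left e1 (hac.trans hac2)
    have h2 := mul_le_mul_of_nonneg_right hac2 hM
    linarith
  · calc _ ≤ 2 * c ^ 2 * profileNormSq m * (4 * m ^ 2 * shellVolume m ^ 2 * ∫ t, f t) :=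
          mul_le_mul_of_nonneg_left e2 (by positivity)
      _ ≤ 2 * c ^ 2 * (3 * m * shellVolume m) * (4 * m ^ 2 * shellVolume m ^ 2 * ∫ t, f t) := by
          have := profileNormSq_le hm
          gcongr
      _ = _ := by ring

/-! ### Choice of the amplitudes -/

theorem re_fourier_le {f : ℝ → ℝ} (hf0 : ∀ t, 0 ≤ f t) (u : ℝ) :
    (fourier f u).re ≤ ∫ t, f t := by
  refine (Complex.re_le_norm _).trans ((norm_integral_le_integral_norm _).trans_eq ?_)
  refine integral_congr_ae (Filter.Eventually.of_forall fun t => ?_)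
  have e : -Complex.I * u * t = ((-(u * t) : ℝ) : ℂ) * Complex.I := by
    push_cast
    ring
  simp only
  rw [norm_mul, e, Complex.norm_exp_ofReal_mul_I, Complex.norm_real,
    Real.norm_of_nonneg (hf0 t), one_mul]

/-- The minimization over the amplitude `μ` of the two-particle component. If `I = 0`, then `P = 0`,
and both sides vanish. -/
theorem amplitude_bound {P I μ : ℝ} (hP : 0 ≤ P) (hPI : P ≤ I)
    (hμ : μ = P / (192 * I)) :
    -(μ * P / 4) + 24 * μ ^ 2 * I ≤ -(P ^ 2 / (1536 * I)) := by
  rcases (hP.trans hPI).eq_or_lt with h | h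
  · simp [hμ, ← h]
  · rw [hμ]
    apply le_of_eq
    field_simp
    ring

end KleinGordon

end

theorem mainTheorem2 :
    ∃ Γ : ℝ, 0 < Γ ∧
      ∀ (m₀ : ℝ) (_ : 0 ≤ m₀)
        (f : ℝ → ℝ) (_ : ContDiff ℝ ∞ f) (_ : HasCompactSupport f)
        (_ : ∀ t, 0 ≤ f t) (_ : ∀ t, f (-t) = f t)
        (_ : ∀ u : ℝ, 0 ≤ (KleinGordon.fourier f u).re)
        (φ : ℝ → ℝ) (_ : AntitoneOn φ (Set.Ici m₀)) (_ : ∀ u ∈ Set.Ici m₀, 0 ≤ φ u)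
        (_ : ∀ u ∈ Set.Ici m₀, φ |u| ≤ (KleinGordon.fourier f u).re)
        (m : ℝ) (_ : m₀ < m),
        ∃ Ψ : KleinGordon.Fock,
          ‖Ψ‖ = 1 ∧ KleinGordon.IsVacuumPlusTwoParticle Ψ ∧ KleinGordon.IsHadamard m Ψ ∧
          (∫ t : ℝ, KleinGordon.energyDensity m Ψ (t, 0) * f t)
            ≤ -(Γ / ∫ t : ℝ, f t) * m ^ 4 * φ (2 * Real.sqrt 2 * m) ^ 2 := by
  refine ⟨KleinGordon.shellVolume 1 / 3072, div_pos KleinGordon.shellVolume_one_pos (by norm_num),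
    ?_⟩
  intro m₀ hm₀ f hf hs hf0 _ _ φ hφ hφ0 hφf m hm₀m
  have hm : 0 < m := hm₀.trans_lt hm₀m
  have hs2 : 1 ≤ Real.sqrt 2 := Real.one_le_sqrt.2 (by norm_num)
  have hmem : 2 * Real.sqrt 2 * m ∈ Ici m₀ := mem_Ici.2 (by nlinarith)
  set P := φ (2 * Real.sqrt 2 * m)
  set I := ∫ t, f t
  have hP : 0 ≤ P := hφ0 _ hmem
  have hI : 0 ≤ I := integral_nonneg hf0
  have hfP : ∀ u, 2 * m ≤ u → u ≤ 2 * Real.sqrt 2 * m → P ≤ (KleinGordon.fourier f u).re := by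
    intro u h1 h2
    have hu : u ∈ Ici m₀ := mem_Ici.2 (by linarith)
    have h3 := hφf u hu
    rw [abs_of_nonneg (by linarith)] at h3
    exact (hφ hu hmem h2).trans h3
  have hPI : P ≤ I := (hfP (2 * m) le_rfl (by nlinarith)).trans (KleinGordon.re_fourier_le hf0 _)
  set V := KleinGordon.shellVolume m
  have hV1 := KleinGordon.shellVolume_one_pos
  have hVeq : V = m ^ 3 * KleinGordon.shellVolume 1 := KleinGordon.shellVolume_eq hm
  have hV : 0 < V := by
    rw [hVeq]
    positivity
  set B := KleinGordon.profileNormSq m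
  have hB0 : 0 ≤ B := KleinGordon.profileNormSq_nonneg hm
  have hB : B ≤ 3 * m * V := KleinGordon.profileNormSq_le hm
  -- `μ` is the dimensionless amplitude of the two-particle component relative to the vacuum.
  obtain ⟨μ, hμ⟩ : ∃ μ, μ = P / (192 * I) := ⟨_, rfl⟩
  have hμ0 : 0 ≤ μ := by
    rw [hμ]
    positivity
  have hμ1 : μ ≤ 1 / 192 := by
    rw [hμ]
    refine div_le_of_le_mul₀ (by positivity) (by norm_num) ?_
    linarith
  set lam := μ / (m * V)
  have hlam0 : 0 ≤ lam := by positivity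
  have hlam : lam * (m * V) = μ := div_mul_cancel₀ _ (by positivity)
  set n := 1 + (lam * B) ^ 2
  have hn : 0 < n := by positivity
  have hn2 : n ≤ 2 := by
    have h1 : lam * B ≤ 1 := by
      have := mul_le_mul_of_nonneg_left hB hlam0
      nlinarith
    have h2 : 0 ≤ lam * B := by positivity
    show 1 + (lam * B) ^ 2 ≤ 2
    nlinarith
  -- `a` normalizes the vector.
  obtain ⟨a, ha⟩ : ∃ a, a = (Real.sqrt n)⁻¹ := ⟨_, rfl⟩
  have ha0 : 0 < a := by
    rw [ha]
    positivity
  have ha2 : a ^ 2 = n⁻¹ := by rw [ha, inv_pow, Real.sq_sqrt hn.le]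
  refine ⟨KleinGordon.shellState m a (a * lam), ?_,
    KleinGordon.isVacuumPlusTwoParticle_pairState ha0.ne' _ _,
    KleinGordon.isHadamard_shellState hm _ _, ?_⟩
  · have h : ‖KleinGordon.shellState m a (a * lam)‖ ^ 2 = 1 := by
      rw [KleinGordon.norm_shellState_sq hm]
      calc a ^ 2 + (a * lam) ^ 2 * B ^ 2 = a ^ 2 * n := by ring
        _ = 1 := by rw [ha2, inv_mul_cancel₀ hn.ne']
    exact (pow_eq_one_iff_of_nonneg (norm_nonneg _) two_ne_zero).1 h
  · refine (KleinGordon.integral_energyDensity_le hm hf.continuous hs hf0 hP hfP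
      (by positivity)).trans ?_
    have hA := KleinGordon.amplitude_bound hP hPI hμ
    have hmV : 0 ≤ m * V := by positivity
    have ha3 : 1 / 2 ≤ a ^ 2 := by
      rw [ha2, one_div]
      exact inv_anti₀ hn hn2
    calc -(a * (a * lam) * (m ^ 2 / 4 * P * V ^ 2)) + 24 * (a * lam) ^ 2 * m ^ 3 * V ^ 3 * I
        = a ^ 2 * (m * V * (-(lam * (m * V) * P / 4) + 24 * (lam * (m * V)) ^ 2 * I)) := by ring
      _ ≤ a ^ 2 * (m * V * -(P ^ 2 / (1536 * I))) := by
          rw [hlam]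
          gcongr
      _ ≤ 1 / 2 * (m * V * -(P ^ 2 / (1536 * I))) := by
          refine mul_le_mul_of_nonpos_right ha3 ?_
          have : 0 ≤ m * V * (P ^ 2 / (1536 * I)) := by positivity
          linarith
      _ = -(KleinGordon.shellVolume 1 / 3072 / I) * m ^ 4 * P ^ 2 := by
          rw [hVeq]
          simp only [div_eq_mul_inv, mul_inv]
          ring
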